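/- **Lemma 4.4.** Let $d\in\{2,3\}$ and let $\sigma,\tau$ be real constants. There is a constant $c>0$, depending only on $d,\sigma,\tau$, such that the following holds. Let $\Omega\subset\mathbb R^d$ be a bounded open set, let $\Omega_k\subset\Omega$ be a nonempty open subset (for example one of the two subdomains into which a smooth interface divides $\Omega$), and let $\mathcal T_h$ be a conforming triangulation of $\Omega$ by finitely many closed nondegenerate $d$-simplices, $\bigcup_{K\in\mathcal T_h}K=\overline\Omega$, with mesh size $h=\max_K h_K$, $h_K=\operatorname{diam}K$. Assume that $\mathcal T_h$ is shape regular (every $K$ contains a ball of some radius $\rho>0$ with $h_K\le\sigma\rho$) and quasiuniform ($h\le\tau h_K$ for every $K$). For $\delta\ge 0$ put $$\mathcal T_{h,k}=\{K\in\mathcal T_h:\ \exists\,x\in K,\ \operatorname{dist}(x,\Omega_k)\le\delta\},\qquad \Omega_{h,k}=\operatorname{int}\Big(\bigcup_{K\in\mathcal T_{h,k}}K\Big).$$ Let $\{\varphi_j\}_{j}$ be the nodal basis of the space of functions that are continuous on the open set $\Omega_{h,k}$ and affine on each $K\in\mathcal T_{h,k}$, no boundary condition being imposed. Explicitly, there is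 one $\varphi_j$ for every vertex $x_j$ and every class of simplices of $\mathcal T_{h,k}$ containing $x_j$ that are connected to each other through facets containing $x_j$ (a single class, unless $\Omega_{h,k}$ is pinched at $x_j$); on the simplices of the class $\varphi_j$ is the barycentric coordinate of $x_j$, and it is $0$ on the other simplices. For $\mathbf v\in (L^2(\Omega_{h,k}))^d$ let $$\mathcal P_k\mathbf v=\sum_{j}\frac{\int_{\Omega_{h,k}}\mathbf v\,\varphi_j\,dx}{\int_{\Omega_{h,k}}\varphi_j\,dx}\,\varphi_j,\qquad s_{h,k}(u,v)=\int_{\Omega_{h,k}}(\nabla u-\mathcal P_k\nabla u)\cdot\nabla v\,dx,\quad u,v\in H^1(\Omega_{h,k}).$$ Let $\mathcal P_k^0$ be the operator obtained by summing only over those $j$ with $x_j\notin\partial\Omega\cap\partial\Omega_{h,k}$ (homogeneous boundary condition), and let $s^0_{h,k}$ be the corresponding form. Then: 1. (Continuity) $|s_{h,k}(u,v)|\le c\,\|u\|_{H^1(\Omega_{h,k})}\|v\|_{H^1(\Omega_{h,k})}$ and $|s^0_{h,k}(u,v)|\le c\,\|u\|_{H^1(\Omega_{h,k})}\|v\|_{H^1(\Omega_{h,k})}$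 for all $u,v\in H^1(\Omega_{h,k})$. 2. (Weak consistency) $s_{h,k}(u,u)\le c\,h^2\,\|u\|^2_{H^2(\Omega_{h,k})}$ for all $u\in H^2(\Omega_{h,k})$. -/

import Mathlib

open MeasureTheory

open scoped ContDiff

noncomputable section

namespace PG

/-- Euclidean space of dimension `d`. -/
abbrev E (d : ℕ) : Type := EuclideanSpace ℝ (Fin d)

/-! ### Sobolev spaces through weak derivatives -/

/-- `G` is a weak gradient of `u` on the open set `U`: for every test function `φ ∈ C_c^∞(U)` and
every coordinate `i` one has `∫_U u ∂ᵢφ = - ∫_U Gᵢ φ`. -/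
def IsWeakGrad {d : ℕ} (U : Set (E d)) (u : E d → ℝ) (G : E d → E d) : Prop :=
  ∀ φ : E d → ℝ, ContDiff ℝ ∞ φ → HasCompactSupport φ → tsupport φ ⊆ U →
    ∀ i : Fin d,
      ∫ x in U, u x * fderiv ℝ φ x (EuclideanSpace.single i (1 : ℝ)) = - ∫ x in U, G x i * φ x

/-- `u ∈ H¹(U)`: `u` is square integrable on `U` and has a square integrable weak gradient. -/
def MemH1 {d : ℕ} (U : Set (E d)) (u : E d → ℝ) : Prop :=
  MemLp u 2 (volume.restrict U) ∧
    ∃ G : E d → E d, MemLp G 2 (volume.restrict U) ∧ IsWeakGrad U u G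

open Classical in
/-- The weak gradient `∇u` of `u ∈ H¹(U)`; it is unique up to null sets of `U`. -/
def weakGrad {d : ℕ} (U : Set (E d)) (u : E d → ℝ) : E d → E d :=
  if h : ∃ G : E d → E d, MemLp G 2 (volume.restrict U) ∧ IsWeakGrad U u G then h.choose else 0

/-- The weak partial derivative `∂ᵢu` of `u ∈ H¹(U)`. -/
def weakPartial {d : ℕ} (U : Set (E d)) (u : E d → ℝ) (i : Fin d) : E d → ℝ :=
  fun x => weakGrad U u x i

/-- `‖u‖²_{H¹(U)} = ‖u‖²_{L²(U)} + ‖∇u‖²_{L²(U)}`. -/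
def normSqH1 {d : ℕ} (U : Set (E d)) (u : E d → ℝ) : ℝ :=
  (∫ x in U, u x ^ 2) + ∫ x in U, ‖weakGrad U u x‖ ^ 2

/-- `‖u‖_{H¹(U)}`. -/
def normH1 {d : ℕ} (U : Set (E d)) (u : E d → ℝ) : ℝ :=
  Real.sqrt (normSqH1 U u)

/-- `u ∈ H²(U)`: `u` and all its weak first derivatives belong to `H¹(U)`. -/
def MemH2 {d : ℕ} (U : Set (E d)) (u : E d → ℝ) : Prop :=
  MemH1 U u ∧ ∀ i : Fin d, MemH1 U (weakPartial U u i)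

/-- `‖u‖²_{H²(U)} = ‖u‖²_{L²(U)} + ‖∇u‖²_{L²(U)} + ‖∇²u‖²_{L²(U)}`. -/
def normSqH2 {d : ℕ} (U : Set (E d)) (u : E d → ℝ) : ℝ :=
  normSqH1 U u + ∑ i : Fin d, ∫ x in U, ‖weakGrad U (weakPartial U u i) x‖ ^ 2

/-- `‖u‖_{H²(U)}`. -/
def normH2 {d : ℕ} (U : Set (E d)) (u : E d → ℝ) : ℝ :=
  Real.sqrt (normSqH2 U u)

/-! ### Triangulations -/

/-- The closed simplex spanned by a finite set of vertices. -/
def cell {d : ℕ} (K : Finset (E d)) : Set (E d) := convexHull ℝ (K : Set (E d))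

/-- A conforming triangulation of `Ω` by finitely many nondegenerate closed `d`-simplices, each of
them given by its set of `d + 1` vertices: the simplices cover exactly the closure of `Ω`, and two
of them meet in the simplex spanned by their common vertices (which may be empty). -/
structure Triangulation {d : ℕ} (Ω : Set (E d)) where
  cells : Finset (Finset (E d))
  card_eq : ∀ K ∈ cells, K.card = d + 1
  affineIndependent : ∀ K ∈ cells, AffineIndependent ℝ (fun p : K => (p : E d))
  conforming : ∀ K ∈ cells, ∀ L ∈ cells,
    cell K ∩ cell L = convexHull ℝ ((K : Set (E d)) ∩ (L : Set (E d)))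
  cover : ⋃ K ∈ cells, cell K = closure Ω

namespace Triangulation

variable {d : ℕ} {Ω : Set (E d)}

/-- The mesh size `h = max_K diam K`. -/
def meshSize (T : Triangulation Ω) : ℝ := ⨆ K : T.cells, Metric.diam (cell (K : Finset (E d)))

/-- Shape regularity with constant `σ`: every `K` contains a ball of some radius `ρ > 0` with
`diam K ≤ σ ρ`. -/
def ShapeRegular (T : Triangulation Ω) (σ : ℝ) : Prop :=
  ∀ K ∈ T.cells, ∃ (x : E d) (ρ : ℝ), 0 < ρ ∧ Metric.ball x ρ ⊆ cell K ∧
    Metric.diam (cell K) ≤ σ * ρ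

/-- Quasiuniformity with constant `τ`: `h ≤ τ diam K` for every `K`. -/
def QuasiUniform (T : Triangulation Ω) (τ : ℝ) : Prop :=
  ∀ K ∈ T.cells, T.meshSize ≤ τ * Metric.diam (cell K)

open Classical in
/-- The sub-triangulation of the simplices that contain a point at distance at most `δ`
from `A`. -/
def subcells (T : Triangulation Ω) (A : Set (E d)) (δ : ℝ) : Finset (Finset (E d)) :=
  T.cells.filter (fun K => ∃ x ∈ cell K, Metric.infDist x A ≤ δ)

end Triangulation

/-- The open mesh domain `int (⋃_{K ∈ S} K)` of a finite set `S` of simplices. -/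
def meshDomain {d : ℕ} (S : Finset (Finset (E d))) : Set (E d) := interior (⋃ K ∈ S, cell K)

/-! ### Nodal basis of the continuous piecewise affine functions -/

open Classical in
/-- The barycentric coordinate of the point `x` that belongs to the vertex `z` of the nondegenerate
`d`-simplex with vertex set `K`. -/
def bary {d : ℕ} (K : Finset (E d)) (z x : E d) : ℝ :=
  if h : AffineIndependent ℝ (fun p : K => (p : E d)) ∧
      affineSpan ℝ (Set.range (fun p : K => (p : E d))) = ⊤ ∧ z ∈ K then
    (AffineBasis.mk (fun p : K => (p : E d)) h.1 h.2.1).coord ⟨z, h.2.2⟩ x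
  else 0

open Classical in
/-- Two simplices of `S` that share a facet containing the vertex `z`. -/
def FacetAdj {d : ℕ} (S : Finset (Finset (E d))) (z : E d) (K L : Finset (E d)) : Prop :=
  K ∈ S ∧ L ∈ S ∧ z ∈ K ∧ z ∈ L ∧ (K ∩ L).card = d

open Classical in
/-- The patch `ω` of simplices around the vertex `z` of `K ∈ S`: all simplices of `S` that can be
reached from `K` through facets containing `z`. -/
def patch {d : ℕ} (S : Finset (Finset (E d))) (K : Finset (E d)) (z : E d) :
    Finset (Finset (E d)) :=
  S.filter (fun L => Relation.ReflTransGen (FacetAdj S z) K L)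

open Classical in
/-- The nodes (degrees of freedom) of the space of functions that are continuous on the open set
`meshDomain S` and affine on every `K ∈ S`. A node is a vertex `z` together with its patch. The
patch consists of all simplices of `S` that contain `z`, except where the open set `meshDomain S`
is pinched at `z`: there it falls, near `z`, into several parts, continuity on the open set does
not couple the values at `z` that are taken from different parts, and each part has its own
degree of freedom. -/
def nodes {d : ℕ} (S : Finset (Finset (E d))) : Finset (E d × Finset (Finset (E d))) :=
  S.biUnion (fun K => K.image (fun z => (z, patch S K z)))

open Classical in
/-- The nodal basis function of the node `(z, C)`: on the simplices of the patch `C` it is the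
barycentric coordinate of `z`, so it takes the value `1` at `z` and `0` at the other vertices, and
it vanishes off the patch. -/
def hat {d : ℕ} (j : E d × Finset (Finset (E d))) (x : E d) : ℝ :=
  if h : ∃ K ∈ j.2, x ∈ cell K then bary h.choose j.1 x else 0

open Classical in
/-- The nodes of `S` whose vertex does not lie in `D`. For `D = ∅` these are all nodes; for
`D = ∂Ω ∩ ∂Ω_h` they are the degrees of freedom that remain when the finite element functions are
required to vanish on `∂Ω ∩ ∂Ω_h`. -/
def freeNodes {d : ℕ} (S : Finset (Finset (E d))) (D : Set (E d)) :
    Finset (E d × Finset (Finset (E d))) :=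
  (nodes S).filter (fun j => j.1 ∉ D)

/-! ### The projected gradient stabilization -/

/-- The coefficient `g_j(w) = ∫ w φ_j / ∫ φ_j`, with integrals over the mesh domain. -/
def coeff {d : ℕ} (S : Finset (Finset (E d))) (w : E d → E d)
    (j : E d × Finset (Finset (E d))) : E d :=
  (∫ x in meshDomain S, hat j x)⁻¹ • ∫ x in meshDomain S, hat j x • w x

/-- The lumped-mass projection `P w = ∑_j g_j(w) φ_j`, the sum being over the nodes off `D`. -/
def lumpedProj {d : ℕ} (S : Finset (Finset (E d))) (D : Set (E d)) (w : E d → E d) :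
    E d → E d :=
  fun x => ∑ j ∈ freeNodes S D, hat j x • coeff S w j

/-- The stabilization form `s(u,v) = ∫_{Ω_h} (∇u - P ∇u) · ∇v`. -/
def stab {d : ℕ} (S : Finset (Finset (E d))) (D : Set (E d)) (u v : E d → ℝ) : ℝ :=
  ∫ x in meshDomain S,
    inner ℝ (weakGrad (meshDomain S) u x -
      lumpedProj S D (weakGrad (meshDomain S) u) x) (weakGrad (meshDomain S) v x)

end PG

end

/-!
The nodal functions `φ_j` form a partition of unity. Writing `w_j` for the mean of `w` with weight
`φ_j`, one has `∫ ⟨w - P w, w⟩ = ∑ⱼ ∫ φ_j |w - w_j|²` and `∫ ⟨P w, v⟩ = ∑ⱼ (∫ φ_j) ⟨w_j, v_j⟩`.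
The second identity gives continuity, since `(∫ φ_j) |w_j|² ≤ ∫ φ_j |w|²`. In the first one `w_j`
may be replaced by any other constant, so that weak consistency amounts to a Poincaré inequality
for `w = ∇u` on the patches of the nodes, with the factor `h²` and a constant that depends only on
the regularity of the mesh.

To keep track of that constant, oscillations are measured by the mean square differences
`∬ |w x - w y|² dμ(x) dν(y)`. On a convex set they are bounded by integrating the gradient along
segments, after a mollification since `w` is only weakly differentiable. Two neighbouring simplices
of a patch overlap, in balls of size comparable to `h`, with a ball around the centroid of the facet
they share, and this ball lies in their union; the estimate on the ball therefore links the two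
simplices. Finally the differences add up along chains of neighbouring simplices. The length of the
chains is bounded because the simplices of a patch do not overlap, lie in a ball of radius `h` and
contain balls of comparable size.
-/

namespace PG

open scoped ENNReal Convolution

/-! ### The Poincaré inequality on convex sets -/

section MeanSquareDifference

variable {α F : Type*} [MeasurableSpace α] [NormedAddCommGroup F] {w : α → F} {μ ν ρ : Measure α}

lemma sq_lintegral_le_lintegral_sq [IsProbabilityMeasure μ] {f : α → ℝ≥0∞}
    (hf : AEMeasurable f μ) : (∫⁻ x, f x ∂μ) ^ 2 ≤ ∫⁻ x, f x ^ 2 ∂μ := by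
  have hölder := ENNReal.lintegral_mul_le_Lp_mul_Lq μ Real.HolderConjugate.two_two hf
    (aemeasurable_const (b := (1 : ℝ≥0∞)))
  simp only [Pi.mul_apply, mul_one, ENNReal.one_rpow, lintegral_const, measure_univ] at hölder
  calc (∫⁻ x, f x ∂μ) ^ 2 ≤ ((∫⁻ x, f x ^ (2 : ℝ) ∂μ) ^ (1 / 2 : ℝ)) ^ 2 := by gcongr
    _ = ∫⁻ x, f x ^ 2 ∂μ := by
      rw [← ENNReal.rpow_natCast, ← ENNReal.rpow_mul]
      simp

lemma enorm_sub_sq_le (a b c : F) :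
    ‖a - b‖ₑ ^ 2 ≤ 2 * ‖a - c‖ₑ ^ 2 + 2 * ‖c - b‖ₑ ^ 2 := by
  have convexity (s t : ℝ≥0∞) : (s + t) ^ 2 ≤ 2 * s ^ 2 + 2 * t ^ 2 := by
    have h := ENNReal.rpow_add_le_mul_rpow_add_rpow s t one_le_two
    norm_num only [ENNReal.rpow_ofNat, ENNReal.rpow_one] at h
    rwa [mul_add] at h
  refine le_trans ?_ (convexity _ _)
  gcongr
  simpa only [edist_eq_enorm_sub] using edist_triangle a c b

/-- The mean square difference `∬ |w(x) - w(y)|² dμ(x) dν(y)`. -/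
noncomputable def sqDiff (w : α → F) (μ ν : Measure α) : ℝ≥0∞ :=
  ∫⁻ p, ‖w p.1 - w p.2‖ₑ ^ 2 ∂μ.prod ν

lemma aemeasurable_enorm_sub_sq [SFinite ν] (hμ : AEStronglyMeasurable w μ)
    (hν : AEStronglyMeasurable w ν) :
    AEMeasurable (fun p : α × α => ‖w p.1 - w p.2‖ₑ ^ 2) (μ.prod ν) :=
  (hμ.comp_fst.sub hν.comp_snd).enorm.pow_const 2

lemma sqDiff_eq_lintegral_lintegral [SFinite ν] (hμ : AEStronglyMeasurable w μ)
    (hν : AEStronglyMeasurable w ν) :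
    sqDiff w μ ν = ∫⁻ x, ∫⁻ y, ‖w x - w y‖ₑ ^ 2 ∂ν ∂μ :=
  lintegral_prod _ (aemeasurable_enorm_sub_sq hμ hν)

lemma sqDiff_comm [SFinite μ] [SFinite ν] (w : α → F) : sqDiff w μ ν = sqDiff w ν μ := by
  rw [sqDiff, ← lintegral_prod_swap]
  simp only [sqDiff, Prod.fst_swap, Prod.snd_swap, enorm_sub_rev]

lemma sqDiff_mono [SFinite μ] [SFinite ν] {μ' ν' : Measure α} [SFinite μ'] [SFinite ν']
    (w : α → F) (hμ : μ ≤ μ') (hν : ν ≤ ν') : sqDiff w μ ν ≤ sqDiff w μ' ν' :=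
  lintegral_mono' (Measure.prod_mono hμ hν) le_rfl

lemma lintegral_enorm_sub_sq_le [IsFiniteMeasure ρ] (hρ : AEStronglyMeasurable w ρ) (a b : F) :
    ρ Set.univ * ‖a - b‖ₑ ^ 2 ≤
      2 * (∫⁻ z, ‖a - w z‖ₑ ^ 2 ∂ρ) + 2 * ∫⁻ z, ‖w z - b‖ₑ ^ 2 ∂ρ := by
  have meas : AEMeasurable (fun z => 2 * ‖a - w z‖ₑ ^ 2) ρ :=
    ((aestronglyMeasurable_const.sub hρ).enorm.pow_const 2).const_mul 2
  calc ρ Set.univ * ‖a - b‖ₑ ^ 2 = ∫⁻ _, ‖a - b‖ₑ ^ 2 ∂ρ := by rw [lintegral_const, mul_comm]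
    _ ≤ ∫⁻ z, (2 * ‖a - w z‖ₑ ^ 2 + 2 * ‖w z - b‖ₑ ^ 2) ∂ρ :=
        lintegral_mono fun z => enorm_sub_sq_le a b (w z)
    _ = _ := by
        rw [lintegral_add_left' meas, lintegral_const_mul' _ _ (by simp),
          lintegral_const_mul' _ _ (by simp)]

lemma measure_univ_mul_sqDiff_le [IsFiniteMeasure μ] [IsFiniteMeasure ν] [IsFiniteMeasure ρ]
    (hμ : AEStronglyMeasurable w μ) (hν : AEStronglyMeasurable w ν)
    (hρ : AEStronglyMeasurable w ρ) :
    ρ Set.univ * sqDiff w μ ν ≤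
      2 * (ν Set.univ * sqDiff w μ ρ + μ Set.univ * sqDiff w ρ ν) := by
  have inner_bound (x : α) : ρ Set.univ * ∫⁻ y, ‖w x - w y‖ₑ ^ 2 ∂ν ≤
      2 * ν Set.univ * (∫⁻ z, ‖w x - w z‖ₑ ^ 2 ∂ρ) + 2 * sqDiff w ρ ν := by
    rw [sqDiff_comm, sqDiff_eq_lintegral_lintegral hν hρ,
      ← lintegral_const_mul' _ _ (measure_ne_top ρ _), ← lintegral_const_mul' 2 _ (by simp)]
    refine (lintegral_mono fun y => lintegral_enorm_sub_sq_le hρ (w x) (w y)).trans_eq ?_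
    rw [lintegral_add_left measurable_const, lintegral_const]
    simp only [enorm_sub_rev]
    ring
  rw [sqDiff_eq_lintegral_lintegral hμ hν, sqDiff_eq_lintegral_lintegral hμ hρ,
    ← lintegral_const_mul' _ _ (measure_ne_top ρ _)]
  refine (lintegral_mono inner_bound).trans_eq ?_
  rw [lintegral_add_right _ measurable_const, lintegral_const,
    lintegral_const_mul' _ _ (by finiteness)]
  ring

lemma sqDiff_triangle [IsFiniteMeasure μ] [IsFiniteMeasure ν] [IsFiniteMeasure ρ]
    (hμ : AEStronglyMeasurable w μ) (hν : AEStronglyMeasurable w ν)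
    (hρ : AEStronglyMeasurable w ρ) {v k : ℝ≥0∞} (hv : v ≠ 0) (hμv : μ Set.univ ≤ v)
    (hνv : ν Set.univ ≤ v) (hvρ : v ≤ k * ρ Set.univ) :
    sqDiff w μ ν ≤ 2 * k * (sqDiff w μ ρ + sqDiff w ρ ν) := by
  have hρ0 : ρ Set.univ ≠ 0 := by
    intro h
    rw [h, mul_zero] at hvρ
    exact hv (le_bot_iff.1 hvρ)
  rw [← ENNReal.mul_le_mul_iff_right hρ0 (measure_ne_top ρ _)]
  calc ρ Set.univ * sqDiff w μ ν
      ≤ 2 * (ν Set.univ * sqDiff w μ ρ + μ Set.univ * sqDiff w ρ ν) :=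
        measure_univ_mul_sqDiff_le hμ hν hρ
    _ ≤ 2 * (k * ρ Set.univ * sqDiff w μ ρ + k * ρ Set.univ * sqDiff w ρ ν) := by
        gcongr
        · exact hνv.trans hvρ
        · exact hμv.trans hvρ
    _ = ρ Set.univ * (2 * k * (sqDiff w μ ρ + sqDiff w ρ ν)) := by ring

lemma exists_measure_univ_mul_lintegral_sub_le [IsFiniteMeasure μ] [SFinite ν] (hμ0 : μ ≠ 0)
    (hμ : AEStronglyMeasurable w μ) (hν : AEStronglyMeasurable w ν) :
    ∃ c, μ Set.univ * ∫⁻ x, ‖w x - c‖ₑ ^ 2 ∂ν ≤ sqDiff w μ ν := by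
  obtain ⟨y, hy⟩ := exists_le_laverage hμ0 (aemeasurable_enorm_sub_sq hμ hν).lintegral_prod_right'
  refine ⟨w y, ?_⟩
  simp only [enorm_sub_rev _ (w y)]
  calc μ Set.univ * ∫⁻ x, ‖w y - w x‖ₑ ^ 2 ∂ν
      ≤ μ Set.univ * ⨍⁻ y, ∫⁻ x, ‖w y - w x‖ₑ ^ 2 ∂ν ∂μ := by gcongr
    _ = sqDiff w μ ν := by
        rw [laverage_eq, sqDiff_eq_lintegral_lintegral hμ hν,
          ENNReal.mul_div_cancel (by simpa using hμ0) (measure_ne_top μ _)]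

lemma sqDiff_le_liminf [SFinite ν] {f : ℕ → α → F}
    (hfμ : ∀ n, AEStronglyMeasurable (f n) μ) (hfν : ∀ n, AEStronglyMeasurable (f n) ν)
    (hμ : ∀ᵐ x ∂μ, Filter.Tendsto (f · x) Filter.atTop (nhds (w x)))
    (hν : ∀ᵐ x ∂ν, Filter.Tendsto (f · x) Filter.atTop (nhds (w x))) :
    sqDiff w μ ν ≤ Filter.liminf (fun n => sqDiff (f n) μ ν) Filter.atTop := by
  refine le_trans (lintegral_mono_ae ?_)
    (lintegral_liminf_le' fun n => aemeasurable_enorm_sub_sq (hfμ n) (hfν n))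
  filter_upwards [Measure.quasiMeasurePreserving_fst.ae hμ,
    Measure.quasiMeasurePreserving_snd.ae hν] with p h₁ h₂
  have cont : Continuous fun z : F => ‖z‖ₑ ^ 2 := by fun_prop
  exact ((cont.tendsto _).comp (h₁.sub h₂)).liminf_eq.ge

lemma sqDiff_restrict_iUnion_le [SFinite μ] (w : α → F) {W : ℕ → Set α} (hW : Monotone W)
    {C : ℝ≥0∞} (hC : ∀ n, sqDiff w (μ.restrict (W n)) (μ.restrict (W n)) ≤ C) :
    sqDiff w (μ.restrict (⋃ n, W n)) (μ.restrict (⋃ n, W n)) ≤ C := by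
  simp only [sqDiff, Measure.prod_restrict] at hC ⊢
  rw [← Set.iUnion_prod_of_monotone hW hW, setLIntegral_iUnion_of_directed]
  · exact iSup_le hC
  · exact directed_of_isDirected_le fun m n hmn => Set.prod_mono (hW hmn) (hW hmn)

end MeanSquareDifference

section ConvexPoincare

open AffineMap Module

variable {V F : Type*} [NormedAddCommGroup V] [NormedSpace ℝ V] [NormedAddCommGroup F]
  [NormedSpace ℝ F]

lemma enorm_sub_sq_le_lintegral_lineMap {f : V → F} (hf : ContDiff ℝ 1 f) {x y : V} {h : ℝ}
    (hxy : dist x y ≤ h) :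
    ‖f x - f y‖ₑ ^ 2 ≤
      ENNReal.ofReal (h ^ 2) * ∫⁻ s in Set.Icc (0 : ℝ) 1, ‖fderiv ℝ f (lineMap x y s)‖ₑ ^ 2 := by
  have : IsProbabilityMeasure (volume.restrict (Set.Icc (0 : ℝ) 1)) := ⟨by simp⟩
  have cont : Continuous fun s : ℝ => fderiv ℝ f (lineMap x y s) :=
    (hf.continuous_fderiv one_ne_zero).comp lineMap_continuous
  have deriv_le (s : ℝ) : ‖deriv (fun s : ℝ => f (lineMap x y s)) s‖ₑ ≤
      ENNReal.ofReal h * ‖fderiv ℝ f (lineMap x y s)‖ₑ := by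
    have := ((hf.differentiable one_ne_zero _).hasFDerivAt.comp_hasDerivAt s
      (hasDerivAt_lineMap (a := x) (b := y))).deriv
    rw [Function.comp_def] at this
    rw [this, mul_comm]
    refine ((fderiv ℝ f _).le_opENorm _).trans ?_
    gcongr
    rw [← edist_eq_enorm_sub, edist_comm, edist_dist]
    exact ENNReal.ofReal_le_ofReal hxy
  have ftc : ‖f x - f y‖ₑ ≤ ∫⁻ s in Set.Icc (0 : ℝ) 1,
      ENNReal.ofReal h * ‖fderiv ℝ f (lineMap x y s)‖ₑ := by
    have := enorm_sub_le_lintegral_deriv_of_contDiffOn_Icc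
      (hf.comp (ContinuousAffineMap.lineMap (R := ℝ) x y).contDiff).contDiffOn
      (zero_le_one (α := ℝ))
    simp only [Function.comp_def, ContinuousAffineMap.coe_lineMap_eq, lineMap_apply_one,
      lineMap_apply_zero] at this
    rw [enorm_sub_rev]
    exact this.trans (lintegral_mono deriv_le)
  calc ‖f x - f y‖ₑ ^ 2
      ≤ (∫⁻ s in Set.Icc (0 : ℝ) 1, ENNReal.ofReal h * ‖fderiv ℝ f (lineMap x y s)‖ₑ) ^ 2 := by
        gcongr
    _ ≤ ∫⁻ s in Set.Icc (0 : ℝ) 1, (ENNReal.ofReal h * ‖fderiv ℝ f (lineMap x y s)‖ₑ) ^ 2 :=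
        sq_lintegral_le_lintegral_sq (cont.enorm.measurable.const_mul _).aemeasurable
    _ = _ := by
        simp only [mul_pow, ← ENNReal.ofReal_pow (dist_nonneg.trans hxy)]
        rw [lintegral_const_mul' _ _ ENNReal.ofReal_ne_top]

variable [MeasurableSpace V] [BorelSpace V] [FiniteDimensional ℝ V] {μ : Measure V}
  [μ.IsAddHaarMeasure] {A : Set V} {g : V → ℝ≥0∞}

lemma lintegral_comp_lineMap_le (hg : Measurable g) {s : ℝ} (hs : s ≤ 1 / 2) (y : V) :
    ∫⁻ x, g (lineMap x y s) ∂μ ≤ 2 ^ finrank ℝ V * ∫⁻ x, g x ∂μ := by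
  have hs0 : 0 < 1 - s := by linarith
  have scale : ∫⁻ x, g (lineMap x y s) ∂μ =
      ENNReal.ofReal |((1 - s) ^ finrank ℝ V)⁻¹| * ∫⁻ x, g x ∂μ := by
    simp only [lineMap_apply_module]
    have := lintegral_map (μ := μ) (f := fun z => g (z + s • y)) (by fun_prop)
      (measurable_const_smul (1 - s))
    rw [← this, Measure.map_addHaar_smul _ hs0.ne', lintegral_smul_measure,
      lintegral_add_right_eq_self, smul_eq_mul]
  rw [scale]
  gcongr
  rw [abs_of_pos (by positivity), ← inv_pow, ENNReal.ofReal_pow (by positivity)]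
  gcongr
  rw [← ENNReal.ofReal_ofNat 2]
  exact ENNReal.ofReal_le_ofReal (by rw [inv_le_comm₀ hs0 two_pos]; linarith)

lemma setLIntegral_comp_lineMap_le (hA : Convex ℝ A) (hAm : MeasurableSet A) (hg : Measurable g)
    {s : ℝ} (hs0 : 0 ≤ s) (hs : s ≤ 1 / 2) {y : V} (hy : y ∈ A) :
    ∫⁻ x in A, g (lineMap x y s) ∂μ ≤ 2 ^ finrank ℝ V * ∫⁻ x in A, g x ∂μ := by
  calc ∫⁻ x in A, g (lineMap x y s) ∂μ
      = ∫⁻ x in A, A.indicator g (lineMap x y s) ∂μ := by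
        refine setLIntegral_congr_fun hAm fun x hx => ?_
        rw [Set.indicator_of_mem (hA.lineMap_mem hx hy ⟨hs0, by linarith⟩)]
    _ ≤ ∫⁻ x, A.indicator g (lineMap x y s) ∂μ := setLIntegral_le_lintegral _ _
    _ ≤ 2 ^ finrank ℝ V * ∫⁻ x, A.indicator g x ∂μ :=
        lintegral_comp_lineMap_le (hg.indicator hAm) hs y
    _ = _ := by rw [lintegral_indicator hAm]

-- One of the weights `1 - s`, `s` of the endpoints is at least `1 / 2`; the substitution is made
-- in that endpoint.
lemma setLIntegral_setLIntegral_comp_lineMap_le (hA : Convex ℝ A) (hAm : MeasurableSet A)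
    (hg : Measurable g) {s : ℝ} (hs : s ∈ Set.Icc (0 : ℝ) 1) :
    ∫⁻ x in A, ∫⁻ y in A, g (lineMap x y s) ∂μ ∂μ ≤
      2 ^ finrank ℝ V * μ A * ∫⁻ x in A, g x ∂μ := by
  have integrate {H : V → ℝ≥0∞} (hH : ∀ y ∈ A, H y ≤ 2 ^ finrank ℝ V * ∫⁻ x in A, g x ∂μ) :
      ∫⁻ y in A, H y ∂μ ≤ 2 ^ finrank ℝ V * μ A * ∫⁻ x in A, g x ∂μ :=
    (setLIntegral_mono' hAm hH).trans_eq (by rw [setLIntegral_const]; ring)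
  rcases le_total s (1 / 2) with h | h
  · rw [lintegral_lintegral_swap]
    · exact integrate fun y hy => setLIntegral_comp_lineMap_le hA hAm hg hs.1 h hy
    · simp only [Function.uncurry_def, lineMap_apply_module]
      fun_prop
  · refine integrate fun x hx => ?_
    simpa only [lineMap_apply_one_sub] using setLIntegral_comp_lineMap_le (μ := μ) hA hAm hg
      (sub_nonneg.2 hs.2) (by linarith : 1 - s ≤ 1 / 2) hx

lemma sqDiff_le_lintegral_fderiv {f : V → F} (hf : ContDiff ℝ 1 f) (hA : Convex ℝ A)
    (hAm : MeasurableSet A) {h : ℝ} (hd : ∀ x ∈ A, ∀ y ∈ A, dist x y ≤ h) :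
    sqDiff f (μ.restrict A) (μ.restrict A) ≤
      2 ^ finrank ℝ V * ENNReal.ofReal (h ^ 2) * μ A * ∫⁻ x in A, ‖fderiv ℝ f x‖ₑ ^ 2 ∂μ := by
  have hf' : Continuous (fderiv ℝ f) := hf.continuous_fderiv one_ne_zero
  have meas (s : ℝ) : Measurable fun p : V × V => ‖fderiv ℝ f (lineMap p.1 p.2 s)‖ₑ ^ 2 := by
    simp only [lineMap_apply_module]
    exact (Continuous.measurable (by fun_prop)).pow_const 2
  have meas' : Measurable fun q : (V × V) × ℝ =>
      ‖fderiv ℝ f (lineMap q.1.1 q.1.2 q.2)‖ₑ ^ 2 := by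
    simp only [lineMap_apply_module]
    exact (Continuous.measurable (by fun_prop)).pow_const 2
  calc sqDiff f (μ.restrict A) (μ.restrict A)
      ≤ ∫⁻ p in A ×ˢ A, ENNReal.ofReal (h ^ 2) *
          (∫⁻ s in Set.Icc (0 : ℝ) 1, ‖fderiv ℝ f (lineMap p.1 p.2 s)‖ₑ ^ 2) ∂μ.prod μ := by
        rw [sqDiff, Measure.prod_restrict]
        exact setLIntegral_mono' (hAm.prod hAm) fun p hp =>
          enorm_sub_sq_le_lintegral_lineMap hf (hd _ hp.1 _ hp.2)
    _ = ENNReal.ofReal (h ^ 2) * ∫⁻ s in Set.Icc (0 : ℝ) 1, ∫⁻ x in A, ∫⁻ y in A,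
          ‖fderiv ℝ f (lineMap x y s)‖ₑ ^ 2 ∂μ ∂μ := by
        rw [lintegral_const_mul' _ _ (by simp), lintegral_lintegral_swap meas'.aemeasurable,
          ← Measure.prod_restrict]
        simp only [lintegral_prod _ (meas _).aemeasurable]
    _ ≤ ENNReal.ofReal (h ^ 2) * ∫⁻ _ in Set.Icc (0 : ℝ) 1,
          2 ^ finrank ℝ V * μ A * ∫⁻ x in A, ‖fderiv ℝ f x‖ₑ ^ 2 ∂μ := by
        gcongr ENNReal.ofReal (h ^ 2) * ?_
        exact setLIntegral_mono' measurableSet_Icc fun s hs =>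
          setLIntegral_setLIntegral_comp_lineMap_le hA hAm (hf'.enorm.measurable.pow_const 2) hs
    _ = _ := by
        rw [setLIntegral_const, Real.volume_Icc, sub_zero, ENNReal.ofReal_one, mul_one]
        ring

end ConvexPoincare

section Mollification

lemma lintegral_enorm_convolution_sq_le {G F : Type*} [AddGroup G] [MeasurableSpace G]
    [MeasurableAdd₂ G] [MeasurableNeg G] {μ : Measure G} [SFinite μ] [μ.IsAddRightInvariant]
    [NormedAddCommGroup F] [NormedSpace ℝ F] {η : G → ℝ} (hη : Measurable η) (hη0 : 0 ≤ η)
    (hη1 : ∫ x, η x ∂μ = 1) {g : G → F} (hg : AEStronglyMeasurable g μ) :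
    ∫⁻ x, ‖(η ⋆[ContinuousLinearMap.lsmul ℝ ℝ, μ] g) x‖ₑ ^ 2 ∂μ ≤ ∫⁻ x, ‖g x‖ₑ ^ 2 ∂μ := by
  set ν : Measure G := μ.withDensity fun t => ‖η t‖ₑ
  have hνμ : ν ≪ μ := withDensity_absolutelyContinuous _ _
  have : IsProbabilityMeasure ν := by
    have hηi : Integrable η μ := by
      by_contra h
      exact zero_ne_one ((integral_undef h).symm.trans hη1)
    refine ⟨?_⟩
    rw [withDensity_apply _ MeasurableSet.univ, Measure.restrict_univ]
    simp only [Real.enorm_eq_ofReal (hη0 _)]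
    rw [← ofReal_integral_eq_lintegral_ofReal hηi (Filter.Eventually.of_forall hη0), hη1,
      ENNReal.ofReal_one]
  have shift (x : G) : AEStronglyMeasurable (fun t => g (x - t)) μ :=
    hg.comp_quasiMeasurePreserving (quasiMeasurePreserving_sub_left_of_right_invariant μ x)
  calc ∫⁻ x, ‖(η ⋆[ContinuousLinearMap.lsmul ℝ ℝ, μ] g) x‖ₑ ^ 2 ∂μ
      ≤ ∫⁻ x, (∫⁻ t, ‖g (x - t)‖ₑ ∂ν) ^ 2 ∂μ := by
        gcongr with x
        refine (enorm_integral_le_lintegral_enorm _).trans_eq ?_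
        rw [lintegral_withDensity_eq_lintegral_mul₀ hη.enorm.aemeasurable (shift x).enorm]
        simp only [ContinuousLinearMap.lsmul_apply, enorm_smul, Pi.mul_apply]
    _ ≤ ∫⁻ x, ∫⁻ t, ‖g (x - t)‖ₑ ^ 2 ∂ν ∂μ := by
        gcongr with x
        exact sq_lintegral_le_lintegral_sq ((shift x).mono_ac hνμ).enorm
    _ = ∫⁻ t, ∫⁻ x, ‖g (x - t)‖ₑ ^ 2 ∂μ ∂ν :=
        lintegral_lintegral_swap ((hg.comp_quasiMeasurePreserving
          (quasiMeasurePreserving_sub_of_right_invariant μ ν)).enorm.pow_const 2)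
    _ = ∫⁻ x, ‖g x‖ₑ ^ 2 ∂μ := by
        simp only [fun t => lintegral_sub_right_eq_self (μ := μ) (fun x => ‖g x‖ₑ ^ 2) t,
          lintegral_const, measure_univ, mul_one]

variable {d : ℕ} {F : Type*} [NormedAddCommGroup F] [NormedSpace ℝ F]
  (φ : ContDiffBump (0 : E d)) {V : Set (E d)}

/-- The mollification, by the normalized bump function `φ`, of `f` restricted to `V` and extended
by zero. -/
noncomputable def mollify (V : Set (E d)) (f : E d → F) : E d → F :=
  φ.normed volume ⋆[ContinuousLinearMap.lsmul ℝ ℝ, volume] V.indicator f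

lemma mollify_apply (hV : MeasurableSet V) (f : E d → F) (x : E d) :
    mollify φ V f x = ∫ t in V, φ.normed volume (x - t) • f t := by
  rw [mollify, convolution_lsmul_swap, ← integral_indicator hV, Set.indicator_smul]

lemma lintegral_enorm_mollify_sq_le (hV : MeasurableSet V) {f : E d → F}
    (hf : AEStronglyMeasurable f (volume.restrict V)) :
    ∫⁻ x, ‖mollify φ V f x‖ₑ ^ 2 ≤ ∫⁻ x in V, ‖f x‖ₑ ^ 2 := by
  refine (lintegral_enorm_convolution_sq_le φ.continuous_normed.measurable φ.nonneg_normed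
    φ.integral_normed ((aestronglyMeasurable_indicator_iff hV).2 hf)).trans_eq ?_
  rw [← lintegral_indicator hV]
  refine lintegral_congr fun x => ?_
  by_cases hx : x ∈ V <;> simp [hx]

lemma contDiff_mollify (hV : MeasurableSet V) {f : E d → F} (hf : IntegrableOn f V) :
    ContDiff ℝ 1 (mollify φ V f) :=
  φ.hasCompactSupport_normed.contDiff_convolution_left _ φ.contDiff_normed
    ((integrable_indicator_iff hV).2 hf).locallyIntegrable

lemma ae_tendsto_mollify {φ : ℕ → ContDiffBump (0 : E d)}
    (hφ : Filter.Tendsto (fun n => (φ n).rOut) Filter.atTop (nhds 0))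
    (hφ' : ∀ n, (φ n).rOut ≤ 2 * (φ n).rIn) (hV : MeasurableSet V) {f : E d → F} [CompleteSpace F]
    (hf : IntegrableOn f V) :
    ∀ᵐ x ∂volume.restrict V,
      Filter.Tendsto (fun n => mollify (φ n) V f x) Filter.atTop (nhds (f x)) := by
  rw [ae_restrict_iff' hV]
  filter_upwards [ContDiffBump.ae_convolution_tendsto_right_of_locallyIntegrable hφ
    (Filter.Eventually.of_forall hφ')
    ((integrable_indicator_iff hV).2 hf).locallyIntegrable] with x hx hxV
  rwa [Set.indicator_of_mem hxV] at hx

lemma fderiv_mollify_apply (hV : MeasurableSet V) {w : E d → ℝ} (hw : IntegrableOn w V)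
    (x v : E d) :
    fderiv ℝ (mollify φ V w) x v = ∫ t in V, w t * fderiv ℝ (φ.normed volume) (x - t) v := by
  have hwl : LocallyIntegrable (V.indicator w) :=
    ((integrable_indicator_iff hV).2 hw).locallyIntegrable
  have hφ : ContDiff ℝ 1 (φ.normed (volume : Measure (E d))) := φ.contDiff_normed
  rw [mollify, ← convolution_flip, (φ.hasCompactSupport_normed.hasFDerivAt_convolution_right _ hwl
    hφ x).fderiv, convolution_precompR_apply _ hwl (φ.hasCompactSupport_normed.fderiv ℝ)
    (hφ.continuous_fderiv one_ne_zero), convolution_def, ← integral_indicator hV]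
  congr 1 with t
  by_cases ht : t ∈ V <;> simp [ht, mul_comm]

variable {w : E d → ℝ} {G : E d → E d}

lemma IsWeakGrad.integral_mul_fderiv_sub (hwG : IsWeakGrad V w G) {η : E d → ℝ}
    (hη : ContDiff ℝ ∞ η) {r : ℝ} (hηr : tsupport η ⊆ Metric.closedBall 0 r) {x : E d}
    (hx : Metric.closedBall x r ⊆ V) (i : Fin d) :
    ∫ t in V, w t * fderiv ℝ η (x - t) (EuclideanSpace.single i 1) =
      ∫ t in V, G t i * η (x - t) := by
  have chain (t : E d) : fderiv ℝ (fun t => η (x - t)) t = -fderiv ℝ η (x - t) := by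
    have := ((hη.differentiable (by simp)) (x - t)).hasFDerivAt.comp t
      ((hasFDerivAt_id t).const_sub x)
    exact this.fderiv.trans (by simp)
  have support : tsupport (fun t => η (x - t)) ⊆ Metric.closedBall x r := by
    refine (tsupport_comp_subset_preimage η (by fun_prop)).trans fun t ht => ?_
    simpa [dist_eq_norm, norm_sub_rev] using hηr ht
  have test := hwG (fun t => η (x - t)) (hη.comp (contDiff_const.sub contDiff_id))
    ((isCompact_closedBall x r).of_isClosed_subset (isClosed_tsupport _) support)
    (support.trans hx) i
  simpa only [chain, neg_apply, mul_neg, integral_neg, neg_inj] using test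

lemma IsWeakGrad.hasGradientAt_mollify (hwG : IsWeakGrad V w G) (hV : MeasurableSet V)
    (hw : IntegrableOn w V) (hG : IntegrableOn G V) {x : E d}
    (hx : Metric.closedBall x φ.rOut ⊆ V) :
    HasGradientAt (mollify φ V w) (mollify φ V G x) x := by
  have integrand : IntegrableOn (fun t => φ.normed volume (x - t) • G t) V := by
    obtain ⟨C, hC⟩ := φ.hasCompactSupport_normed.exists_bound_of_continuous
      (φ.continuous_normed (μ := volume))
    exact hG.bdd_smul C (φ.continuous_normed.comp (by fun_prop)).aestronglyMeasurable
      (Filter.Eventually.of_forall fun t => hC (x - t))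
  have coord (i : Fin d) :
      fderiv ℝ (mollify φ V w) x (EuclideanSpace.single i 1) = mollify φ V G x i := by
    rw [fderiv_mollify_apply φ hV hw, hwG.integral_mul_fderiv_sub φ.contDiff_normed
      φ.tsupport_normed_eq.subset hx, mollify_apply φ hV]
    refine Eq.trans ?_ ((EuclideanSpace.proj (𝕜 := ℝ) i : E d →L[ℝ] ℝ).integral_comp_comm integrand)
    simp [mul_comm]
  have : fderiv ℝ (mollify φ V w) x = InnerProductSpace.toDual ℝ (E d) (mollify φ V G x) :=
    ContinuousLinearMap.coe_injective ((EuclideanSpace.basisFun (Fin d) ℝ).toBasis.ext fun i => by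
      simp [coord, EuclideanSpace.inner_single_right])
  rw [hasGradientAt_iff_hasFDerivAt, ← this]
  exact ((contDiff_mollify φ hV hw).differentiable one_ne_zero x).hasFDerivAt

end Mollification

section WeakPoincare

variable {d : ℕ} {U V : Set (E d)} {w : E d → ℝ} {G : E d → E d}

lemma IsWeakGrad.mono (hwG : IsWeakGrad U w G) (hVU : V ⊆ U) : IsWeakGrad V w G := by
  intro φ hφ hφc hφV i
  have hφ0 : ∀ x ∉ V, φ x = 0 := fun x hx =>
    image_eq_zero_of_notMem_tsupport fun h => hx (hφV h)
  have hdφ0 : ∀ x ∉ V, fderiv ℝ φ x = 0 := fun x hx =>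
    image_eq_zero_of_notMem_tsupport fun h => hx (hφV (tsupport_fderiv_subset ℝ h))
  have shrink {f : E d → ℝ} (hf : ∀ x ∉ V, f x = 0) : ∫ x in V, f x = ∫ x in U, f x :=
    (setIntegral_eq_integral_of_forall_compl_eq_zero hf).trans
      (setIntegral_eq_integral_of_forall_compl_eq_zero fun x hx => hf x (mt (@hVU x) hx)).symm
  rw [shrink fun x hx => by simp [hdφ0 x hx], shrink fun x hx => by simp [hφ0 x hx]]
  exact hwG φ hφ hφc (hφV.trans hVU) i

/-- The inner parallel set of `V`: the centers of the closed balls of radius `r` inside `V`. -/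
def erosion (V : Set (E d)) (r : ℝ) : Set (E d) := {x | Metric.closedBall x r ⊆ V}

lemma erosion_subset {r : ℝ} (hr : 0 ≤ r) : erosion V r ⊆ V :=
  fun _ hx => hx (Metric.mem_closedBall_self hr)

lemma isOpen_erosion (hV : IsOpen V) {r : ℝ} (hr : 0 ≤ r) : IsOpen (erosion V r) := by
  have : (erosion V r)ᶜ = Metric.cthickening r Vᶜ := by
    rw [hV.isClosed_compl.cthickening_eq_biUnion_closedBall hr]
    ext x
    simp [erosion, Set.not_subset, dist_comm, and_comm]
  rw [← isClosed_compl_iff, this]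
  exact Metric.isClosed_cthickening

lemma convex_erosion (hV : Convex ℝ V) (r : ℝ) : Convex ℝ (erosion V r) := by
  have : erosion V r = ⋂ v ∈ Metric.closedBall (0 : E d) r, (fun x => v + x) ⁻¹' V := by
    ext x
    simp only [erosion, Set.mem_ofPred_eq, Set.mem_iInter, Set.mem_preimage,
      mem_closedBall_zero_iff]
    refine ⟨fun h v hv => h (by simpa using hv), fun h y hy => ?_⟩
    simpa using h (y - x) (by rwa [← mem_closedBall_iff_norm])
  rw [this]
  exact convex_iInter₂ fun v _ => hV.translate_preimage_right v

lemma iUnion_erosion (hV : IsOpen V) : ⋃ n : ℕ, erosion V (1 / (n + 1 : ℝ)) = V := by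
  refine Set.Subset.antisymm (Set.iUnion_subset fun n => erosion_subset (by positivity))
    fun x hx => ?_
  obtain ⟨ε, hε, hball⟩ := Metric.isOpen_iff.1 hV x hx
  obtain ⟨n, hn⟩ := exists_nat_one_div_lt hε
  exact Set.mem_iUnion.2 ⟨n, (Metric.closedBall_subset_ball hn).trans hball⟩

lemma monotone_erosion (V : Set (E d)) : Monotone fun n : ℕ => erosion V (1 / (n + 1 : ℝ)) :=
  fun _ _ hmn _ hx => (Metric.closedBall_subset_closedBall (Nat.one_div_le_one_div hmn)).trans hx

lemma sqDiff_mollify_erosion_le (hVo : IsOpen V) (hV : Convex ℝ V) {h : ℝ}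
    (hd : ∀ x ∈ V, ∀ y ∈ V, dist x y ≤ h) (hw : IntegrableOn w V) (hG : IntegrableOn G V)
    (hwG : IsWeakGrad V w G) (φ : ContDiffBump (0 : E d)) {r : ℝ} (hφr : φ.rOut ≤ r) :
    sqDiff (mollify φ V w) (volume.restrict (erosion V r)) (volume.restrict (erosion V r)) ≤
      2 ^ d * ENNReal.ofReal (h ^ 2) * volume V * ∫⁻ x in V, ‖G x‖ₑ ^ 2 := by
  have hr : 0 ≤ r := φ.rOut_pos.le.trans hφr
  have hW : erosion V r ⊆ V := erosion_subset hr
  have hWm : MeasurableSet (erosion V r) := (isOpen_erosion hVo hr).measurableSet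
  have enorm_fderiv : ∀ x ∈ erosion V r,
      ‖fderiv ℝ (mollify φ V w) x‖ₑ = ‖mollify φ V G x‖ₑ := fun x hx => by
    rw [(hwG.hasGradientAt_mollify φ hVo.measurableSet hw hG
      ((Metric.closedBall_subset_closedBall hφr).trans hx)).hasFDerivAt.fderiv,
      LinearIsometryEquiv.enorm_map]
  calc sqDiff (mollify φ V w) (volume.restrict (erosion V r)) (volume.restrict (erosion V r))
      ≤ 2 ^ d * ENNReal.ofReal (h ^ 2) * volume (erosion V r) *
          ∫⁻ x in erosion V r, ‖fderiv ℝ (mollify φ V w) x‖ₑ ^ 2 := by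
        simpa using sqDiff_le_lintegral_fderiv (contDiff_mollify φ hVo.measurableSet hw)
          (convex_erosion hV r) hWm fun x hx y hy => hd x (hW hx) y (hW hy)
    _ = 2 ^ d * ENNReal.ofReal (h ^ 2) * volume (erosion V r) *
          ∫⁻ x in erosion V r, ‖mollify φ V G x‖ₑ ^ 2 := by
        congr 1
        exact setLIntegral_congr_fun hWm fun x hx => by rw [enorm_fderiv x hx]
    _ ≤ 2 ^ d * ENNReal.ofReal (h ^ 2) * volume V * ∫⁻ x in V, ‖G x‖ₑ ^ 2 := by
        exact mul_le_mul' (by gcongr) ((setLIntegral_le_lintegral _ _).trans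
          (lintegral_enorm_mollify_sq_le φ hVo.measurableSet hG.aestronglyMeasurable))

-- Mollify at scales tending to zero, first on a fixed erosion of `V`, and then exhaust `V`.
theorem sqDiff_le_of_isWeakGrad (hVo : IsOpen V) (hV : Convex ℝ V) {h : ℝ}
    (hd : ∀ x ∈ V, ∀ y ∈ V, dist x y ≤ h) (hw : IntegrableOn w V) (hG : IntegrableOn G V)
    (hwG : IsWeakGrad V w G) :
    sqDiff w (volume.restrict V) (volume.restrict V) ≤
      2 ^ d * ENNReal.ofReal (h ^ 2) * volume V * ∫⁻ x in V, ‖G x‖ₑ ^ 2 := by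
  obtain ⟨φ, hφ, hφ'⟩ : ∃ φ : ℕ → ContDiffBump (0 : E d),
      Filter.Tendsto (fun n => (φ n).rOut) Filter.atTop (nhds 0) ∧
      ∀ n, (φ n).rOut ≤ 2 * (φ n).rIn :=
    ⟨fun n => ⟨1 / (n + 1) / 2, 1 / (n + 1), by positivity, half_lt_self (by positivity)⟩,
      tendsto_one_div_add_atTop_nhds_zero_nat, fun n => by simp only; linarith⟩
  have meas (n : ℕ) (μ : Measure (E d)) : AEStronglyMeasurable (mollify (φ n) V w) μ :=
    (contDiff_mollify (φ n) hVo.measurableSet hw).continuous.aestronglyMeasurable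
  have conv := ae_tendsto_mollify hφ hφ' hVo.measurableSet hw
  rw [← iUnion_erosion hVo]
  refine sqDiff_restrict_iUnion_le w (monotone_erosion V) fun m => ?_
  have hm : 0 < (1 / (m + 1) : ℝ) := by positivity
  rw [iUnion_erosion hVo]
  have conv' := ae_restrict_of_ae_restrict_of_subset (erosion_subset hm.le) conv
  refine (sqDiff_le_liminf (fun n => meas n _) (fun n => meas n _) conv' conv').trans
    (Filter.liminf_le_of_frequently_le' (Filter.Eventually.frequently ?_))
  filter_upwards [hφ.eventually (gt_mem_nhds hm)] with n hn
  exact sqDiff_mollify_erosion_le hVo hV hd hw hG hwG (φ n) hn.le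

end WeakPoincare

/-! ### Neighbouring simplices -/

section Affine

variable {V P : Type*} [NormedAddCommGroup V] [NormedSpace ℝ V] [MetricSpace P]
  [NormedAddTorsor V P]

lemma abs_affineMap_sub_le (A : P →ᵃ[ℝ] ℝ) {c : P} {ρ : ℝ} (hρ : 0 < ρ)
    (hA : ∀ x ∈ Metric.ball c ρ, A x ∈ Set.Icc (0 : ℝ) 1) (p q : P) :
    |A p - A q| ≤ 2 / ρ * dist p q := by
  have bound : ∀ v ∈ Metric.closedBall (0 : V) (ρ / 2), ‖A.linear v‖ ≤ 1 := fun v hv => by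
    have h₁ := hA (v +ᵥ c) (by
      rw [Metric.mem_ball, dist_vadd_left]
      linarith [mem_closedBall_zero_iff.1 hv])
    have h₀ := hA c (Metric.mem_ball_self hρ)
    rw [A.map_vadd, vadd_eq_add] at h₁
    rw [Real.norm_eq_abs, abs_le]
    constructor <;> linarith [h₁.1, h₁.2, h₀.1, h₀.2]
  have := LinearMap.bound_of_ball_bound' (half_pos hρ) 1 A.linear bound (p -ᵥ q)
  rwa [A.linearMap_vsub, one_div_div, vsub_eq_sub, Real.norm_eq_abs, ← dist_eq_norm_vsub] at this

lemma affineMap_centroid (A : P →ᵃ[ℝ] ℝ) {F : Finset P} (hF : F.Nonempty) :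
    A (F.centroid ℝ id) = (F.card : ℝ)⁻¹ * ∑ y ∈ F, A y := by
  have hw := F.sum_centroidWeights_eq_one_of_nonempty ℝ hF
  rw [Finset.centroid_def, Finset.map_affineCombination _ _ _ hw,
    Finset.affineCombination_eq_linear_combination _ _ _ hw, Finset.mul_sum]
  rfl

lemma ball_lineMap_subset {U : Set V} (hU : Convex ℝ U) {m c : V} {ρ h t : ℝ} (hm : m ∈ U)
    (hb : Metric.ball c ρ ⊆ U) (hcm : dist m c ≤ h) (ht : 0 < t) (ht1 : t ≤ 1) :
    Metric.ball (AffineMap.lineMap m c t) (t * ρ) ⊆ U ∩ Metric.ball m (t * (h + ρ)) := by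
  intro p hp
  obtain ⟨q, rfl⟩ : ∃ q, AffineMap.lineMap m q t = p :=
    ⟨AffineMap.lineMap m p t⁻¹, by simp [AffineMap.lineMap_apply, ht.ne']⟩
  have hqc : dist q c < ρ := by
    simpa [AffineMap.lineMap_apply, dist_smul₀, abs_of_pos ht, ht] using hp
  refine ⟨hU.lineMap_mem hm (hb hqc) ⟨ht.le, ht1⟩, ?_⟩
  rw [Metric.mem_ball, dist_lineMap_left, Real.norm_of_nonneg ht.le]
  gcongr
  linarith [dist_triangle m c q, dist_comm q c]

end Affine

section Simplex

variable {d : ℕ}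

/-- The finite set `K` is the vertex set of a nondegenerate `d`-simplex. -/
structure IsSimplex (K : Finset (E d)) : Prop where
  card_eq : K.card = d + 1
  affineIndependent : AffineIndependent ℝ (fun p : K => (p : E d))

lemma isCompact_cell (K : Finset (E d)) : IsCompact (cell K) :=
  K.finite_toSet.isCompact_convexHull (𝕜 := ℝ)

lemma convex_cell (K : Finset (E d)) : Convex ℝ (cell K) := convex_convexHull ℝ _

namespace IsSimplex

variable {K L F : Finset (E d)} {x z : E d} {ρ : ℝ}

lemma affineSpan_eq_top (hK : IsSimplex K) :
    affineSpan ℝ (Set.range (fun p : K => (p : E d))) = ⊤ := by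
  rw [hK.affineIndependent.affineSpan_eq_top_iff_card_eq_finrank_add_one]
  simp [hK.card_eq]

/-- The vertices of a nondegenerate simplex as an affine basis. -/
noncomputable def basis (hK : IsSimplex K) : AffineBasis K ℝ (E d) :=
  AffineBasis.mk (fun p : K => (p : E d)) hK.affineIndependent hK.affineSpan_eq_top

lemma basis_apply (hK : IsSimplex K) (p : K) : hK.basis p = p := rfl

lemma range_basis (hK : IsSimplex K) : Set.range hK.basis = (K : Set (E d)) := by
  ext x
  simp [basis_apply]

lemma bary_eq_coord (hK : IsSimplex K) (hz : z ∈ K) : bary K z = hK.basis.coord ⟨z, hz⟩ := by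
  ext x
  rw [bary, dif_pos ⟨hK.affineIndependent, hK.affineSpan_eq_top, hz⟩]
  rfl

lemma mem_cell_iff (hK : IsSimplex K) : x ∈ cell K ↔ ∀ z ∈ K, 0 ≤ bary K z x := by
  rw [cell, ← hK.range_basis, hK.basis.convexHull_eq_nonneg_coord]
  simp only [Set.mem_ofPred_eq, Subtype.forall]
  exact forall₂_congr fun z hz => by rw [hK.bary_eq_coord hz]

lemma sum_bary (hK : IsSimplex K) (x : E d) : ∑ z ∈ K, bary K z x = 1 := by
  rw [← hK.basis.sum_coord_apply_eq_one x, ← Finset.sum_coe_sort]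
  exact Finset.sum_congr rfl fun z _ => by rw [hK.bary_eq_coord z.2]

lemma bary_mem_Icc (hK : IsSimplex K) (hz : z ∈ K) (hx : x ∈ cell K) :
    bary K z x ∈ Set.Icc 0 1 := by
  refine ⟨hK.mem_cell_iff.1 hx z hz, ?_⟩
  rw [← hK.sum_bary x]
  exact Finset.single_le_sum (fun y hy => hK.mem_cell_iff.1 hx y hy) hz

lemma bary_apply_vertex [DecidableEq (E d)] (hK : IsSimplex K) (hz : z ∈ K) (hx : x ∈ K) :
    bary K z x = if z = x then 1 else 0 := by
  classical
  rw [hK.bary_eq_coord hz]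
  simpa [basis_apply] using hK.basis.coord_apply ⟨z, hz⟩ ⟨x, hx⟩

lemma continuous_bary (hK : IsSimplex K) (hz : z ∈ K) : Continuous (bary K z) := by
  rw [hK.bary_eq_coord hz]
  exact AffineMap.continuous_of_finiteDimensional _

lemma abs_bary_sub_le (hK : IsSimplex K) (hρ : 0 < ρ) {c : E d}
    (hb : Metric.ball c ρ ⊆ cell K) (hz : z ∈ K) (p q : E d) :
    |bary K z p - bary K z q| ≤ 2 / ρ * dist p q := by
  have h : ∀ x ∈ Metric.ball c ρ, bary K z x ∈ Set.Icc 0 1 := fun x hx =>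
    hK.bary_mem_Icc hz (hb hx)
  rw [hK.bary_eq_coord hz] at h ⊢
  exact abs_affineMap_sub_le _ hρ h p q

lemma bary_eq_zero_of_mem_convexHull (hK : IsSimplex K) (hz : z ∈ K) {s : Set (E d)}
    (hs : s ⊆ K) (hzs : z ∉ s) (hx : x ∈ convexHull ℝ s) : bary K z x = 0 := by
  classical
  have hconv : Convex ℝ (bary K z ⁻¹' {0}) := by
    rw [hK.bary_eq_coord hz]
    exact (convex_singleton 0).affine_preimage _
  refine convexHull_min (fun y hy => ?_) hconv hx
  rw [Set.mem_preimage, hK.bary_apply_vertex hz (hs hy),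
    if_neg (ne_of_mem_of_not_mem hy hzs).symm]
  rfl

lemma bary_centroid [DecidableEq (E d)] (hK : IsSimplex K) (hF : F ⊆ K) (hF0 : F.Nonempty)
    (hz : z ∈ K) : bary K z (F.centroid ℝ id) = if z ∈ F then (F.card : ℝ)⁻¹ else 0 := by
  have := affineMap_centroid (hK.basis.coord ⟨z, hz⟩) hF0
  rw [← hK.bary_eq_coord hz] at this
  rw [this, Finset.sum_congr rfl fun y hy => hK.bary_apply_vertex hz (hF hy),
    Finset.sum_ite_eq, mul_ite, mul_one, mul_zero]

lemma bary_pos_of_mem_ball_centroid (hK : IsSimplex K) (hρ : 0 < ρ) {c : E d}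
    (hb : Metric.ball c ρ ⊆ cell K) (hF : F ⊆ K) (hz : z ∈ F)
    (hx : x ∈ Metric.ball (F.centroid ℝ id) (ρ / (2 * (d + 1)))) : 0 < bary K z x := by
  classical
  have hF0 : F.Nonempty := ⟨z, hz⟩
  have card_le : (F.card : ℝ) ≤ d + 1 := by
    exact_mod_cast (Finset.card_le_card hF).trans_eq hK.card_eq
  have lower : (d + 1 : ℝ)⁻¹ ≤ bary K z (F.centroid ℝ id) := by
    rw [hK.bary_centroid hF hF0 (hF hz), if_pos hz]
    exact inv_anti₀ (by exact_mod_cast hF0.card_pos) card_le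
  have upper : |bary K z x - bary K z (F.centroid ℝ id)| < (d + 1 : ℝ)⁻¹ :=
    calc _ ≤ 2 / ρ * dist x (F.centroid ℝ id) := hK.abs_bary_sub_le hρ hb (hF hz) _ _
      _ < 2 / ρ * (ρ / (2 * (d + 1))) := by gcongr; exact hx
      _ = (d + 1 : ℝ)⁻¹ := by field_simp
  linarith [(abs_lt.1 upper).1]

lemma bary_neg_of_mem_ball_centroid [DecidableEq (E d)] (hK : IsSimplex K) (hρ : 0 < ρ)
    {c a : E d} (hb : Metric.ball c ρ ⊆ cell K) (hKF : K = insert a F)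
    (hx : x ∈ Metric.ball (F.centroid ℝ id) (ρ / (2 * (d + 1)))) (hxK : x ∉ cell K) :
    bary K a x < 0 := by
  contrapose! hxK
  refine hK.mem_cell_iff.2 fun z hz => ?_
  rw [hKF, Finset.mem_insert] at hz
  obtain rfl | hz := hz
  · exact hxK
  · exact (hK.bary_pos_of_mem_ball_centroid hρ hb (hKF ▸ Finset.subset_insert a F) hz hx).le

lemma bary_pointReflection_centroid (hK : IsSimplex K) (hF : F ⊆ K)
    (hF0 : F.Nonempty) (hz : z ∈ K) (hzF : z ∉ F) (x : E d) :
    bary K z (Equiv.pointReflection (F.centroid ℝ id) x) = -bary K z x := by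
  classical
  have h := hK.bary_centroid hF hF0 hz
  rw [if_neg hzF] at h
  rw [hK.bary_eq_coord hz] at h ⊢
  rw [Equiv.pointReflection_apply, AffineMap.map_vadd, AffineMap.linearMap_vsub, h]
  simp

lemma exists_eq_insert_inter [DecidableEq (E d)] (hK : IsSimplex K)
    (hKL : (K ∩ L).card = d) : ∃ a ∉ K ∩ L, K = insert a (K ∩ L) := by
  have card_sdiff : (K \ (K ∩ L)).card = 1 := by
    rw [Finset.card_sdiff_of_subset Finset.inter_subset_left, hK.card_eq, hKL]
    omega
  obtain ⟨a, ha⟩ := Finset.card_eq_one.1 card_sdiff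
  have haK : a ∈ K \ (K ∩ L) := ha ▸ Finset.mem_singleton_self a
  refine ⟨a, (Finset.mem_sdiff.1 haK).2, ?_⟩
  rw [Finset.insert_eq, ← ha, Finset.sdiff_union_of_subset Finset.inter_subset_left]

-- A point outside both simplices is reflected through the centroid into both of them, although
-- they only share the facet.
lemma ball_centroid_subset_union [DecidableEq (E d)] (hK : IsSimplex K) (hL : IsSimplex L)
    (hc : cell K ∩ cell L = convexHull ℝ ((K : Set (E d)) ∩ (L : Set (E d))))
    (hKL : (K ∩ L).card = d) (hKL0 : (K ∩ L).Nonempty) (hρ : 0 < ρ) {c c' : E d}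
    (hbK : Metric.ball c ρ ⊆ cell K) (hbL : Metric.ball c' ρ ⊆ cell L) :
    Metric.ball ((K ∩ L).centroid ℝ id) (ρ / (2 * (d + 1))) ⊆ cell K ∪ cell L := by
  intro x hx
  by_contra! hxKL
  rw [Set.mem_union, not_or] at hxKL
  have refl_mem {M : Finset (E d)} (hM : IsSimplex M) {c a : E d}
      (hb : Metric.ball c ρ ⊆ cell M) (haF : a ∉ K ∩ L) (ha : M = insert a (K ∩ L))
      (hxM : x ∉ cell M) : Equiv.pointReflection ((K ∩ L).centroid ℝ id) x ∈ cell M ∧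
        0 < bary M a (Equiv.pointReflection ((K ∩ L).centroid ℝ id) x) := by
    have pos : 0 < bary M a (Equiv.pointReflection ((K ∩ L).centroid ℝ id) x) := by
      rw [hM.bary_pointReflection_centroid (ha ▸ Finset.subset_insert _ _) hKL0
        (ha ▸ Finset.mem_insert_self _ _) haF, neg_pos]
      exact hM.bary_neg_of_mem_ball_centroid hρ hb ha hx hxM
    refine ⟨?_, pos⟩
    by_contra h
    refine (hM.bary_neg_of_mem_ball_centroid hρ hb ha ?_ h).not_gt pos
    rwa [Metric.mem_ball, dist_pointReflection_left, dist_comm]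
  obtain ⟨a, haF, ha⟩ := hK.exists_eq_insert_inter hKL
  obtain ⟨b, hbF, hb⟩ := hL.exists_eq_insert_inter (by rwa [Finset.inter_comm])
  rw [Finset.inter_comm] at hbF hb
  obtain ⟨memK, pos⟩ := refl_mem hK hbK haF ha hxKL.1
  have memL := (refl_mem hL hbL hbF hb hxKL.2).1
  have haK : a ∈ K := ha ▸ Finset.mem_insert_self _ _
  refine pos.ne' (hK.bary_eq_zero_of_mem_convexHull haK Set.inter_subset_left
    (by rwa [← Finset.coe_inter]) ?_)
  rw [← hc]
  exact ⟨memK, memL⟩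

lemma aedisjoint_cell (hK : IsSimplex K) (hL : IsSimplex L)
    (hc : cell K ∩ cell L = convexHull ℝ ((K : Set (E d)) ∩ (L : Set (E d)))) (hKL : K ≠ L) :
    AEDisjoint volume (cell K) (cell L) := by
  classical
  rw [AEDisjoint, hc]
  refine measure_mono_null (convexHull_subset_affineSpan _)
    (Measure.addHaar_affineSubspace _ _ fun htop => hKL ?_)
  rw [← Finset.coe_inter] at htop
  have card_inter : (K ∩ L).card = d + 1 := by
    have hind : AffineIndependent ℝ (fun p : (K ∩ L : Finset (E d)) => (p : E d)) :=
      hK.affineIndependent.mono (by simp)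
    simpa using hind.affineSpan_eq_top_iff_card_eq_finrank_add_one.1 (by
      rwa [Subtype.range_coe_subtype])
  exact (Finset.eq_of_subset_of_card_le Finset.inter_subset_left
      (hK.card_eq.trans card_inter.symm).le).symm.trans
    (Finset.eq_of_subset_of_card_le Finset.inter_subset_right
      (hL.card_eq.trans card_inter.symm).le)

end IsSimplex

end Simplex

/-! ### The Poincaré inequality on vertex patches -/

section Chaining

variable {α F ι : Type*} [MeasurableSpace α] [NormedAddCommGroup F] {w : α → F}
  {Γ : SimpleGraph ι} {μ : ι → Measure α} [∀ i, IsFiniteMeasure (μ i)] {v k X : ℝ≥0∞}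

lemma sqDiff_sum_right [Fintype ι] (w : α → F) (ν : Measure α) [SFinite ν] :
    sqDiff w ν (Measure.sum μ) = ∑ i, sqDiff w ν (μ i) := by
  rw [sqDiff, Measure.prod_sum_right, lintegral_sum_measure, tsum_fintype]
  rfl

lemma sqDiff_le_of_overlap {μ ν μ' ν' ρ : Measure α} [IsFiniteMeasure μ] [IsFiniteMeasure ν]
    [SFinite ρ] (hμ : AEStronglyMeasurable w μ) (hν : AEStronglyMeasurable w ν)
    (hμ'μ : μ' ≤ μ) (hμ'ρ : μ' ≤ ρ) (hν'ν : ν' ≤ ν) (hν'ρ : ν' ≤ ρ)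
    (hv : v ≠ 0) (hk : 1 ≤ k) (hμv : μ Set.univ ≤ v) (hνv : ν Set.univ ≤ v)
    (hvμ' : v ≤ k * μ' Set.univ) (hvν' : v ≤ k * ν' Set.univ) (hXμ : sqDiff w μ μ ≤ X)
    (hXν : sqDiff w ν ν ≤ X) (hXρ : sqDiff w ρ ρ ≤ X) :
    sqDiff w μ ν ≤ 10 * k ^ 2 * X := by
  have := isFiniteMeasure_of_le μ hμ'μ
  have := isFiniteMeasure_of_le ν hν'ν
  have hμ' := hμ.mono_measure hμ'μ
  have hν' := hν.mono_measure hν'ν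
  calc sqDiff w μ ν
      ≤ 2 * k * (sqDiff w μ μ' + sqDiff w μ' ν) := sqDiff_triangle hμ hν hμ' hv hμv hνv hvμ'
    _ ≤ 2 * k * (sqDiff w μ μ' + 2 * k * (sqDiff w μ' ν' + sqDiff w ν' ν)) := by
        gcongr
        exact sqDiff_triangle hμ' hν hν' hv ((hμ'μ _).trans hμv) hνv hvν'
    _ ≤ 2 * k * (X + 2 * k * (X + X)) := by
        gcongr
        · exact (sqDiff_mono w le_rfl hμ'μ).trans hXμ
        · exact (sqDiff_mono w hμ'ρ hν'ρ).trans hXρ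
        · exact (sqDiff_mono w hν'ν le_rfl).trans hXν
    _ = (2 * (k * 1) + 8 * k ^ 2) * X := by ring
    _ ≤ (2 * (k * k) + 8 * k ^ 2) * X := by gcongr
    _ = 10 * k ^ 2 * X := by ring

lemma sqDiff_le_of_walk (hw : ∀ i, AEStronglyMeasurable w (μ i)) (hv : v ≠ 0) (hk : 1 ≤ k)
    (hμv : ∀ i, μ i Set.univ ≤ v) (hvμ : ∀ i, v ≤ k * μ i Set.univ)
    (self_le : ∀ i, sqDiff w (μ i) (μ i) ≤ X)
    (adj_le : ∀ i j, Γ.Adj i j → sqDiff w (μ i) (μ j) ≤ X) {i j : ι} (p : Γ.Walk i j) :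
    sqDiff w (μ i) (μ j) ≤ (4 * k) ^ p.length * X := by
  induction p with
  | nil => simpa using self_le _
  | @cons i l j hil p ih =>
    have one_le : 1 ≤ (4 * k) ^ p.length := one_le_pow₀ (one_le_mul (by norm_num) hk)
    calc sqDiff w (μ i) (μ j)
        ≤ 2 * k * (sqDiff w (μ i) (μ l) + sqDiff w (μ l) (μ j)) :=
          sqDiff_triangle (hw i) (hw j) (hw l) hv (hμv i) (hμv j) (hvμ l)
      _ ≤ 2 * k * (1 * X + (4 * k) ^ p.length * X) := by
          gcongr
          rw [one_mul]
          exact adj_le i l hil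
      _ ≤ 2 * k * ((4 * k) ^ p.length * X + (4 * k) ^ p.length * X) := by gcongr
      _ = (4 * k) ^ (SimpleGraph.Walk.cons hil p).length * X := by
          rw [SimpleGraph.Walk.length_cons, pow_succ]
          ring

lemma exists_mul_sum_lintegral_sub_sq_le [Fintype ι] [Nonempty ι] (hΓ : Γ.Preconnected)
    (hw : ∀ i, AEStronglyMeasurable w (μ i)) (hv : v ≠ 0) (hk : 1 ≤ k)
    (hμv : ∀ i, μ i Set.univ ≤ v) (hvμ : ∀ i, v ≤ k * μ i Set.univ)
    (self_le : ∀ i, sqDiff w (μ i) (μ i) ≤ X)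
    (adj_le : ∀ i j, Γ.Adj i j → sqDiff w (μ i) (μ j) ≤ X) {n : ℕ} (hn : Fintype.card ι ≤ n) :
    ∃ c, v * ∑ i, ∫⁻ x, ‖w x - c‖ₑ ^ 2 ∂μ i ≤ k * n * (4 * k) ^ n * X := by
  obtain ⟨i₀⟩ := ‹Nonempty ι›
  have h4k : 1 ≤ 4 * k := one_le_mul (by norm_num) hk
  have pair_le (i : ι) : sqDiff w (μ i₀) (μ i) ≤ (4 * k) ^ n * X := by
    obtain ⟨p, hp⟩ := (hΓ i₀ i).exists_isPath
    refine (sqDiff_le_of_walk hw hv hk hμv hvμ self_le adj_le p).trans ?_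
    gcongr
    exact hp.length_lt.le.trans hn
  have hμ0 : μ i₀ ≠ 0 := by
    intro h
    have := hvμ i₀
    rw [h, Measure.coe_zero, Pi.zero_apply, mul_zero] at this
    exact hv (le_bot_iff.1 this)
  obtain ⟨c, hc⟩ := exists_measure_univ_mul_lintegral_sub_le hμ0 (hw i₀)
    (AEStronglyMeasurable.sum_measure hw)
  refine ⟨c, ?_⟩
  rw [lintegral_sum_measure, tsum_fintype, sqDiff_sum_right] at hc
  calc v * ∑ i, ∫⁻ x, ‖w x - c‖ₑ ^ 2 ∂μ i
      ≤ k * μ i₀ Set.univ * ∑ i, ∫⁻ x, ‖w x - c‖ₑ ^ 2 ∂μ i := by gcongr; exact hvμ i₀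
    _ ≤ k * ∑ i, sqDiff w (μ i₀) (μ i) := by rw [mul_assoc]; gcongr
    _ ≤ k * ∑ _i : ι, (4 * k) ^ n * X := by gcongr with i; exact pair_le i
    _ = k * Fintype.card ι * (4 * k) ^ n * X := by
        rw [Finset.sum_const, Finset.card_univ, nsmul_eq_mul]
        ring
    _ ≤ k * n * (4 * k) ^ n * X := by gcongr

end Chaining

section Mesh

variable {d : ℕ} {S : Finset (Finset (E d))} {K L : Finset (E d)} {z : E d}

lemma FacetAdj.symm (h : FacetAdj S z K L) : FacetAdj S z L K := by
  obtain ⟨hK, hL, hzK, hzL, hcard⟩ := h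
  exact ⟨hL, hK, hzL, hzK, by rwa [Finset.inter_comm]⟩

lemma mem_patch_iff : L ∈ patch S K z ↔ L ∈ S ∧ Relation.ReflTransGen (FacetAdj S z) K L := by
  simp [patch]

lemma patch_subset (S : Finset (Finset (E d))) (K : Finset (E d)) (z : E d) : patch S K z ⊆ S :=
  fun _ hL => (mem_patch_iff.1 hL).1

lemma mem_of_mem_patch (hz : z ∈ K) (hL : L ∈ patch S K z) : z ∈ L := by
  rcases (mem_patch_iff.1 hL).2.cases_tail with rfl | ⟨M, _, hML⟩
  · exact hz
  · exact hML.2.2.2.1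

/-- The graph on the simplices of the patch of `K` at `z` in which neighbours share a facet
through `z`. -/
def facetGraph (S : Finset (Finset (E d))) (K : Finset (E d)) (z : E d) :
    SimpleGraph (patch S K z) :=
  SimpleGraph.fromRel fun L M => FacetAdj S z L M

lemma facetAdj_of_facetGraph_adj {L M : patch S K z} (h : (facetGraph S K z).Adj L M) :
    FacetAdj S z L M :=
  h.2.elim id FacetAdj.symm

lemma preconnected_facetGraph (hK : K ∈ S) : (facetGraph S K z).Preconnected := by
  have hK' : K ∈ patch S K z := mem_patch_iff.2 ⟨hK, .refl⟩
  have reach (L : Finset (E d)) (hL : Relation.ReflTransGen (FacetAdj S z) K L) :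
      ∀ hL' : L ∈ patch S K z, (facetGraph S K z).Reachable ⟨K, hK'⟩ ⟨L, hL'⟩ := by
    induction hL with
    | refl => exact fun _ => .refl _
    | @tail L M hKL hLM ih =>
      intro hM
      have hL' : L ∈ patch S K z := mem_patch_iff.2 ⟨hLM.1, hKL⟩
      obtain rfl | hne := eq_or_ne L M
      · exact ih hM
      · exact (ih hL').trans
          (SimpleGraph.Adj.reachable ⟨fun h => hne (Subtype.ext_iff.1 h), .inl hLM⟩)
  exact fun L M => (reach L (mem_patch_iff.1 L.2).2 L.2).symm.trans
    (reach M (mem_patch_iff.1 M.2).2 M.2)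

/-- A mesh of size `h` and aspect ratio `θ`: finitely many nondegenerate simplices which meet in
common faces, have diameter at most `h`, and contain balls of radius `h / θ`. -/
structure IsMesh (S : Finset (Finset (E d))) (h θ : ℝ) : Prop where
  pos : 0 < h
  one_le : 1 ≤ θ
  isSimplex : ∀ K ∈ S, IsSimplex K
  conforming : ∀ K ∈ S, ∀ L ∈ S,
    cell K ∩ cell L = convexHull ℝ ((K : Set (E d)) ∩ (L : Set (E d)))
  dist_le : ∀ K ∈ S, ∀ x ∈ cell K, ∀ y ∈ cell K, dist x y ≤ h
  exists_ball_subset : ∀ K ∈ S, ∃ x, Metric.ball x (h / θ) ⊆ cell K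

/-- A bound for the ratio of the volumes of balls of radii `h` and `h / (4 (d + 1) θ²)`, the latter
being the size of the balls that fit into both a simplex and a neighbourhood of one of its facets
contained in the two adjacent simplices. -/
noncomputable def volRatio (d : ℕ) (θ : ℝ) : ℕ := ⌈(4 * (d + 1) * θ ^ 2) ^ d⌉₊

/-- The constant in the Poincaré inequality on vertex patches. -/
noncomputable def patchConst (d : ℕ) (θ : ℝ) : ℕ :=
  40 * 2 ^ d * volRatio d θ ^ 4 * (4 * volRatio d θ) ^ volRatio d θ

lemma volume_le_of_subset_closedBall {h : ℝ} {A : Set (E d)} {x : E d}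
    (hA : A ⊆ Metric.closedBall x h) :
    volume A ≤ volume (Metric.closedBall (0 : E d) h) :=
  (measure_mono hA).trans_eq (Measure.addHaar_closedBall_center _ x h)

namespace IsMesh

variable {h θ : ℝ}

lemma one_le_volRatio (hS : IsMesh S h θ) : 1 ≤ volRatio d θ := by
  have := hS.one_le
  exact Nat.one_le_ceil_iff.2 (by positivity)

lemma volume_closedBall_le (hS : IsMesh S h θ) {c : E d} {A : Set (E d)}
    (hA : Metric.ball c (h / (4 * (d + 1) * θ ^ 2)) ⊆ A) :
    volume (Metric.closedBall (0 : E d) h) ≤ volRatio d θ * volume A := by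
  have hh := hS.pos
  have hθ := hS.one_le
  have radius_pos : 0 < h / (4 * (d + 1) * θ ^ 2) := by positivity
  calc volume (Metric.closedBall (0 : E d) h)
      = ENNReal.ofReal ((4 * (d + 1) * θ ^ 2) ^ d * (h / (4 * (d + 1) * θ ^ 2)) ^ d) *
          volume (Metric.ball (0 : E d) 1) := by
        rw [Measure.addHaar_closedBall _ _ hh.le, ← mul_pow, mul_div_cancel₀ _ (by positivity)]
        simp
    _ ≤ volRatio d θ * volume (Metric.ball c (h / (4 * (d + 1) * θ ^ 2))) := by
        rw [Measure.addHaar_ball_of_pos _ _ radius_pos, finrank_euclideanSpace_fin,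
          ENNReal.ofReal_mul (by positivity), mul_assoc, ← ENNReal.ofReal_natCast]
        gcongr
        exact Nat.le_ceil _
    _ ≤ volRatio d θ * volume A := by gcongr

lemma cell_subset_closedBall (hS : IsMesh S h θ) (hK : K ∈ S) {x : E d} (hx : x ∈ cell K) :
    cell K ⊆ Metric.closedBall x h := fun y hy => hS.dist_le K hK y hy x hx

lemma volume_cell_le (hS : IsMesh S h θ) (hK : K ∈ S) :
    volume (cell K) ≤ volume (Metric.closedBall (0 : E d) h) := by
  obtain h0 | ⟨x, hx⟩ := (cell K).eq_empty_or_nonempty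
  · simp [h0]
  · exact volume_le_of_subset_closedBall (hS.cell_subset_closedBall hK hx)

lemma volume_closedBall_le_mul_volume_cell (hS : IsMesh S h θ) (hK : K ∈ S) :
    volume (Metric.closedBall (0 : E d) h) ≤ volRatio d θ * volume (cell K) := by
  obtain ⟨c, hc⟩ := hS.exists_ball_subset K hK
  refine hS.volume_closedBall_le ((Metric.ball_subset_ball ?_).trans hc)
  have hh := hS.pos
  have hθ := hS.one_le
  gcongr
  nlinarith [Nat.cast_nonneg (α := ℝ) d]

lemma card_patch_le (hS : IsMesh S h θ) (hz : z ∈ K) : (patch S K z).card ≤ volRatio d θ := by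
  have hv0 : volume (Metric.closedBall (0 : E d) h) ≠ 0 :=
    (Metric.measure_closedBall_pos volume _ hS.pos).ne'
  have disjoint : (patch S K z : Set (Finset (E d))).Pairwise
      (Function.onFun (AEDisjoint volume) cell) := fun L hL M hM hLM =>
    have hL := patch_subset S K z hL
    have hM := patch_subset S K z hM
    (hS.isSimplex L hL).aedisjoint_cell (hS.isSimplex M hM) (hS.conforming L hL M hM) hLM
  have packing : (patch S K z).card * volume (Metric.closedBall (0 : E d) h) ≤
      volRatio d θ * volume (Metric.closedBall (0 : E d) h) :=
    calc (patch S K z).card * volume (Metric.closedBall (0 : E d) h)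
        = ∑ _L ∈ patch S K z, volume (Metric.closedBall (0 : E d) h) := by simp
      _ ≤ ∑ L ∈ patch S K z, volRatio d θ * volume (cell L) :=
          Finset.sum_le_sum fun L hL =>
            hS.volume_closedBall_le_mul_volume_cell (patch_subset S K z hL)
      _ = volRatio d θ * volume (⋃ L ∈ patch S K z, cell L) := by
          rw [measure_biUnion_finset₀ disjoint fun L _ =>
            (isCompact_cell L).measurableSet.nullMeasurableSet, Finset.mul_sum]
      _ ≤ volRatio d θ * volume (Metric.closedBall (0 : E d) h) := by
          refine mul_le_mul' le_rfl (volume_le_of_subset_closedBall (x := z) ?_)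
          exact Set.iUnion₂_subset fun L hL =>
            hS.cell_subset_closedBall (patch_subset S K z hL)
              (subset_convexHull ℝ _ (mem_of_mem_patch hz hL))
  rw [ENNReal.mul_le_mul_iff_left hv0 measure_closedBall_lt_top.ne] at packing
  exact_mod_cast packing

lemma exists_ball_subset_inter_ball_centroid (hS : IsMesh S h θ) (hK : K ∈ S)
    {F : Finset (E d)} (hF : F ⊆ K) (hF0 : F.Nonempty) :
    ∃ a, Metric.ball a (h / (4 * (d + 1) * θ ^ 2)) ⊆
      cell K ∩ Metric.ball (F.centroid ℝ id) (h / θ / (2 * (d + 1))) := by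
  have hh := hS.pos
  have hθ := hS.one_le
  have hm : F.centroid ℝ id ∈ cell K :=
    convexHull_mono (Finset.coe_subset.2 hF) (F.centroid_mem_convexHull hF0)
  obtain ⟨c, hc⟩ := hS.exists_ball_subset K hK
  have near := ball_lineMap_subset (convex_cell K) hm hc
    (hS.dist_le K hK _ hm c (hc (Metric.mem_ball_self (by positivity))))
    (t := (4 * (d + 1) * θ)⁻¹) (by positivity)
    (inv_le_one_of_one_le₀ (by nlinarith [Nat.cast_nonneg (α := ℝ) d]))
  refine ⟨_, (Metric.ball_subset_ball (le_of_eq ?_)).trans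
    (near.trans (Set.inter_subset_inter_right _ (Metric.ball_subset_ball ?_)))⟩
  · field_simp
  · calc (4 * (d + 1) * θ)⁻¹ * (h + h / θ) ≤ (4 * (d + 1) * θ)⁻¹ * (h + h) := by
          gcongr
          exact div_le_self hh.le hθ
      _ = h / θ / (2 * (d + 1)) := by field_simp; norm_num

lemma exists_balls_of_facetAdj (hS : IsMesh S h θ) (hKL : FacetAdj S z K L) :
    ∃ m : E d, ∃ r ≤ h, Metric.ball m r ⊆ cell K ∪ cell L ∧
      (∃ a, Metric.ball a (h / (4 * (d + 1) * θ ^ 2)) ⊆ cell K ∩ Metric.ball m r) ∧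
      ∃ b, Metric.ball b (h / (4 * (d + 1) * θ ^ 2)) ⊆ cell L ∩ Metric.ball m r := by
  classical
  obtain ⟨hK, hL, hzK, hzL, hcard⟩ := hKL
  have hcard : (K ∩ L).card = d := by convert hcard
  have hKL0 : (K ∩ L).Nonempty := ⟨z, Finset.mem_inter.2 ⟨hzK, hzL⟩⟩
  have hh := hS.pos
  have hθ := hS.one_le
  have radius_le : h / θ / (2 * (d + 1)) ≤ h := by
    rw [div_div]
    exact div_le_self hh.le (by nlinarith [Nat.cast_nonneg (α := ℝ) d])
  obtain ⟨c, hc⟩ := hS.exists_ball_subset K hK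
  obtain ⟨c', hc'⟩ := hS.exists_ball_subset L hL
  exact ⟨(K ∩ L).centroid ℝ id, _, radius_le,
    (hS.isSimplex K hK).ball_centroid_subset_union (hS.isSimplex L hL)
      (hS.conforming K hK L hL) hcard hKL0 (by positivity) hc hc',
    hS.exists_ball_subset_inter_ball_centroid hK Finset.inter_subset_left hKL0,
    hS.exists_ball_subset_inter_ball_centroid hL Finset.inter_subset_right hKL0⟩

end IsMesh

end Mesh

lemma lintegral_biUnion_finset_le {α ι : Type*} [MeasurableSpace α] {μ : Measure α}
    (s : Finset ι) (A : ι → Set α) (f : α → ℝ≥0∞) :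
    ∫⁻ x in ⋃ i ∈ s, A i, f x ∂μ ≤ ∑ i ∈ s, ∫⁻ x in A i, f x ∂μ := by
  rw [← Finset.sum_coe_sort, ← tsum_fintype (L := .unconditional _), ← lintegral_sum_measure]
  exact lintegral_mono' (Measure.restrict_biUnion_le s.countable_toSet) le_rfl

section PatchPoincare

variable {d : ℕ} {S : Finset (Finset (E d))} {K L : Finset (E d)} {z : E d} {h θ : ℝ}
  {w : E d → ℝ} {G : E d → E d}

lemma interior_cell_ae_eq (K : Finset (E d)) :
    (interior (cell K) : Set (E d)) =ᵐ[volume] cell K :=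
  interior_ae_eq_of_null_frontier ((convex_cell K).addHaar_frontier volume)

instance isFiniteMeasure_restrict_cell (K : Finset (E d)) :
    IsFiniteMeasure (volume.restrict (cell K)) :=
  isFiniteMeasure_restrict.2 (isCompact_cell K).measure_lt_top.ne

lemma interior_cell_subset_meshDomain (hK : K ∈ S) : interior (cell K) ⊆ meshDomain S :=
  interior_mono (Set.subset_biUnion_of_mem (u := cell) hK)

lemma aestronglyMeasurable_cell {F : Type*} [TopologicalSpace F] {f : E d → F}
    (hf : AEStronglyMeasurable f (volume.restrict (meshDomain S))) (hK : K ∈ S) :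
    AEStronglyMeasurable f (volume.restrict (cell K)) := by
  rw [← Measure.restrict_congr_set (interior_cell_ae_eq K)]
  exact hf.mono_set (interior_cell_subset_meshDomain hK)

lemma sqDiff_le_of_subset_closedBall {U V : Set (E d)} (hVo : IsOpen V) (hV : Convex ℝ V)
    {c : E d} (hVc : V ⊆ Metric.closedBall c h) (hVU : V ⊆ U) (hw : IntegrableOn w U)
    (hG : IntegrableOn G U) (hwG : IsWeakGrad U w G) :
    sqDiff w (volume.restrict V) (volume.restrict V) ≤
      2 ^ d * ENNReal.ofReal ((2 * h) ^ 2) * volume (Metric.closedBall (0 : E d) h) *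
        ∫⁻ x in V, ‖G x‖ₑ ^ 2 := by
  have diam_le : ∀ x ∈ V, ∀ y ∈ V, dist x y ≤ 2 * h := fun x hx y hy => by
    rw [two_mul]
    exact (dist_triangle_right x y c).trans (add_le_add (hVc hx) (hVc hy))
  refine (sqDiff_le_of_isWeakGrad hVo hV diam_le (hw.mono_set hVU) (hG.mono_set hVU)
    (hwG.mono hVU)).trans (mul_le_mul' (mul_le_mul' le_rfl ?_) le_rfl)
  exact volume_le_of_subset_closedBall hVc

namespace IsMesh

lemma sqDiff_cell_self_le (hS : IsMesh S h θ) (hw : IntegrableOn w (meshDomain S))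
    (hG : IntegrableOn G (meshDomain S)) (hwG : IsWeakGrad (meshDomain S) w G) (hK : K ∈ S) :
    sqDiff w (volume.restrict (cell K)) (volume.restrict (cell K)) ≤
      2 ^ d * ENNReal.ofReal ((2 * h) ^ 2) * volume (Metric.closedBall (0 : E d) h) *
        ∫⁻ x in cell K, ‖G x‖ₑ ^ 2 := by
  obtain h0 | ⟨c, hc⟩ := (cell K).eq_empty_or_nonempty
  · simp [h0, sqDiff]
  · rw [← Measure.restrict_congr_set (interior_cell_ae_eq K)]
    exact sqDiff_le_of_subset_closedBall isOpen_interior (convex_cell K).interior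
      (interior_subset.trans (hS.cell_subset_closedBall hK hc))
      (interior_cell_subset_meshDomain hK) hw hG hwG

-- The two simplices overlap, in balls of comparable size, with a ball around the centroid of the
-- common facet, to which the Poincaré inequality on convex sets applies as well.
lemma sqDiff_cell_le_of_facetAdj (hS : IsMesh S h θ) (hw : IntegrableOn w (meshDomain S))
    (hG : IntegrableOn G (meshDomain S)) (hwG : IsWeakGrad (meshDomain S) w G)
    (hKL : FacetAdj S z K L) :
    sqDiff w (volume.restrict (cell K)) (volume.restrict (cell L)) ≤
      10 * volRatio d θ ^ 2 * (2 ^ d * ENNReal.ofReal ((2 * h) ^ 2) *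
        volume (Metric.closedBall (0 : E d) h) * ∫⁻ x in cell K ∪ cell L, ‖G x‖ₑ ^ 2) := by
  obtain ⟨m, r, hr, hB, ⟨a, ha⟩, b, hb⟩ := hS.exists_balls_of_facetAdj hKL
  have hK := hKL.1
  have hL := hKL.2.1
  have restrict_le {A B : Set (E d)} (hAB : A ⊆ B) : volume.restrict A ≤ volume.restrict B :=
    Measure.restrict_mono hAB le_rfl
  have ball_subset : Metric.ball m r ⊆ meshDomain S :=
    interior_maximal (hB.trans (Set.union_subset (Set.subset_biUnion_of_mem (u := cell) hK)
      (Set.subset_biUnion_of_mem (u := cell) hL))) Metric.isOpen_ball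
  refine sqDiff_le_of_overlap (ρ := volume.restrict (Metric.ball m r))
    (μ' := volume.restrict (Metric.ball a (h / (4 * (d + 1) * θ ^ 2))))
    (ν' := volume.restrict (Metric.ball b (h / (4 * (d + 1) * θ ^ 2))))
    (aestronglyMeasurable_cell hw.aestronglyMeasurable hK)
    (aestronglyMeasurable_cell hw.aestronglyMeasurable hL)
    (restrict_le (ha.trans Set.inter_subset_left)) (restrict_le (ha.trans Set.inter_subset_right))
    (restrict_le (hb.trans Set.inter_subset_left)) (restrict_le (hb.trans Set.inter_subset_right))
    (v := volume (Metric.closedBall (0 : E d) h)) (Metric.measure_closedBall_pos _ _ hS.pos).ne'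
    (by exact_mod_cast hS.one_le_volRatio) ?_ ?_ ?_ ?_ ?_ ?_ ?_
  any_goals rw [Measure.restrict_apply_univ]
  · exact hS.volume_cell_le hK
  · exact hS.volume_cell_le hL
  · exact hS.volume_closedBall_le subset_rfl
  · exact hS.volume_closedBall_le subset_rfl
  · refine (hS.sqDiff_cell_self_le hw hG hwG hK).trans ?_
    gcongr
    exact Set.subset_union_left
  · refine (hS.sqDiff_cell_self_le hw hG hwG hL).trans ?_
    gcongr
    exact Set.subset_union_right
  · refine (sqDiff_le_of_subset_closedBall Metric.isOpen_ball (convex_ball m r)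
      ((Metric.ball_subset_ball hr).trans Metric.ball_subset_closedBall) ball_subset
      hw hG hwG).trans ?_
    gcongr

lemma exists_mul_sum_lintegral_sub_sq_le_patch (hS : IsMesh S h θ)
    (hw : IntegrableOn w (meshDomain S)) (hG : IntegrableOn G (meshDomain S))
    (hwG : IsWeakGrad (meshDomain S) w G) (hK : K ∈ S) (hz : z ∈ K) :
    ∃ c, volume (Metric.closedBall (0 : E d) h) *
        ∑ L ∈ patch S K z, ∫⁻ x in cell L, ‖w x - c‖ₑ ^ 2 ≤
      volRatio d θ * volRatio d θ * (4 * volRatio d θ) ^ volRatio d θ *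
        (10 * volRatio d θ ^ 2 * (2 ^ d * ENNReal.ofReal ((2 * h) ^ 2) *
          volume (Metric.closedBall (0 : E d) h) *
            ∑ L ∈ patch S K z, ∫⁻ x in cell L, ‖G x‖ₑ ^ 2)) := by
  have : Nonempty (patch S K z) := ⟨⟨K, mem_patch_iff.2 ⟨hK, .refl⟩⟩⟩
  have mem (L : patch S K z) : (L : Finset (E d)) ∈ S := patch_subset S K z L.2
  have hk : (1 : ℝ≥0∞) ≤ volRatio d θ := by exact_mod_cast hS.one_le_volRatio
  have energy_le {A : Set (E d)} (hA : A ⊆ ⋃ L ∈ patch S K z, cell L) :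
      ∫⁻ x in A, ‖G x‖ₑ ^ 2 ≤ ∑ L ∈ patch S K z, ∫⁻ x in cell L, ‖G x‖ₑ ^ 2 :=
    (lintegral_mono_set hA).trans (lintegral_biUnion_finset_le _ _ _)
  have subset_union (L : patch S K z) : cell (L : Finset (E d)) ⊆ ⋃ L ∈ patch S K z, cell L :=
    Set.subset_biUnion_of_mem (u := cell) L.2
  simp only [← Finset.sum_coe_sort (patch S K z) fun L => ∫⁻ x in cell L, ‖w x - _‖ₑ ^ 2]
  refine exists_mul_sum_lintegral_sub_sq_le (preconnected_facetGraph hK)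
    (μ := fun L : patch S K z => volume.restrict (cell (L : Finset (E d))))
    (fun L => aestronglyMeasurable_cell hw.aestronglyMeasurable (mem L))
    (Metric.measure_closedBall_pos _ _ hS.pos).ne' hk (fun L => ?_) (fun L => ?_) (fun L => ?_)
    (fun L M hLM => ?_) ((Fintype.card_coe _).trans_le (hS.card_patch_le hz))
  · rw [Measure.restrict_apply_univ]
    exact hS.volume_cell_le (mem L)
  · rw [Measure.restrict_apply_univ]
    exact hS.volume_closedBall_le_mul_volume_cell (mem L)
  · refine (hS.sqDiff_cell_self_le hw hG hwG (mem L)).trans ?_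
    rw [← one_mul (2 ^ d * _ * _ * _)]
    gcongr
    · exact one_le_mul (by norm_num) (one_le_pow₀ hk)
    · exact energy_le (subset_union L)
  · refine (hS.sqDiff_cell_le_of_facetAdj hw hG hwG (facetAdj_of_facetGraph_adj hLM)).trans ?_
    gcongr
    exact energy_le (Set.union_subset (subset_union L) (subset_union M))

theorem exists_sum_lintegral_sub_sq_le_patch (hS : IsMesh S h θ)
    (hw : IntegrableOn w (meshDomain S)) (hG : IntegrableOn G (meshDomain S))
    (hwG : IsWeakGrad (meshDomain S) w G) (hK : K ∈ S) (hz : z ∈ K) :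
    ∃ c, ∑ L ∈ patch S K z, ∫⁻ x in cell L, ‖w x - c‖ₑ ^ 2 ≤
      patchConst d θ * ENNReal.ofReal (h ^ 2) *
        ∑ L ∈ patch S K z, ∫⁻ x in cell L, ‖G x‖ₑ ^ 2 := by
  obtain ⟨c, hc⟩ := hS.exists_mul_sum_lintegral_sub_sq_le_patch hw hG hwG hK hz
  refine ⟨c, ?_⟩
  rw [← ENNReal.mul_le_mul_iff_right (Metric.measure_closedBall_pos volume (0 : E d) hS.pos).ne'
    measure_closedBall_lt_top.ne]
  refine hc.trans_eq ?_
  rw [patchConst, mul_pow 2 h, ENNReal.ofReal_mul (by norm_num), ENNReal.ofReal_pow zero_le_two,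
    ENNReal.ofReal_ofNat]
  push_cast
  ring

end IsMesh

end PatchPoincare

/-! ### Lumped-mass projections -/

section WeightedMean

variable {X F : Type*} [MeasurableSpace X] {μ : Measure X} [NormedAddCommGroup F]
  [InnerProductSpace ℝ F] {φ : X → ℝ} {v w : X → F}

/-- The mean of `w` with respect to the weight `φ`, the coefficient of a lumped-mass projection; it
is `0` if the weight has integral `0`. -/
noncomputable def weightedMean (μ : Measure X) (φ : X → ℝ) (w : X → F) : F :=
  (∫ x, φ x ∂μ)⁻¹ • ∫ x, φ x • w x ∂μ

lemma integral_smul_weightedMean (hφ : 0 ≤ᵐ[μ] φ) (hφi : Integrable φ μ) (w : X → F) :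
    (∫ x, φ x ∂μ) • weightedMean μ φ w = ∫ x, φ x • w x ∂μ := by
  obtain hm | hm := eq_or_ne (∫ x, φ x ∂μ) 0
  · rw [hm, zero_smul]
    refine (integral_eq_zero_of_ae ?_).symm
    filter_upwards [(integral_eq_zero_iff_of_nonneg_ae hφ hφi).1 hm] with x hx
    rw [hx, Pi.zero_apply, zero_smul, Pi.zero_apply]
  · exact smul_inv_smul₀ hm _

lemma integrable_mul_norm_sub_sq (hφi : Integrable φ μ) (hw : Integrable (fun x => φ x • w x) μ)
    (hw2 : Integrable (fun x => φ x * ‖w x‖ ^ 2) μ) (c : F) :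
    Integrable (fun x => φ x * ‖w x - c‖ ^ 2) μ := by
  refine ((hw2.sub ((hw.const_inner c).const_mul 2)).add (hφi.mul_const (‖c‖ ^ 2))).congr
    (.of_forall fun x => ?_)
  simp only [Pi.add_apply, Pi.sub_apply]
  rw [norm_sub_sq_real, inner_smul_right, real_inner_comm]
  ring

lemma integral_mul_norm_sub_sq [CompleteSpace F] (hφ : 0 ≤ᵐ[μ] φ) (hφi : Integrable φ μ)
    (hw : Integrable (fun x => φ x • w x) μ) (hw2 : Integrable (fun x => φ x * ‖w x‖ ^ 2) μ)
    (c : F) :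
    ∫ x, φ x * ‖w x - c‖ ^ 2 ∂μ = ∫ x, φ x * ‖w x - weightedMean μ φ w‖ ^ 2 ∂μ +
      (∫ x, φ x ∂μ) * ‖weightedMean μ φ w - c‖ ^ 2 := by
  set a := weightedMean μ φ w with ha
  have deviation : Integrable (fun x => φ x • (w x - a)) μ :=
    (hw.sub (hφi.smul_const a)).congr (.of_forall fun _ => (smul_sub _ _ _).symm)
  have cross_eq_zero : ∫ x, inner ℝ (a - c) (φ x • (w x - a)) ∂μ = 0 := by
    rw [integral_inner deviation]
    simp_rw [smul_sub]
    rw [integral_sub hw (hφi.smul_const a), integral_smul_const, ha,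
      integral_smul_weightedMean hφ hφi, sub_self, inner_zero_right]
  have expand (x : X) : φ x * ‖w x - c‖ ^ 2 =
      φ x * ‖w x - a‖ ^ 2 + 2 * inner ℝ (a - c) (φ x • (w x - a)) + φ x * ‖a - c‖ ^ 2 := by
    rw [← sub_add_sub_cancel (w x) a c, norm_add_sq_real, inner_smul_right,
      real_inner_comm (a - c)]
    ring
  have dev_sq := integrable_mul_norm_sub_sq hφi hw hw2 a
  have cross := (deviation.const_inner (𝕜 := ℝ) (a - c)).const_mul 2
  simp_rw [expand]
  rw [integral_add (f := fun x => φ x * ‖w x - a‖ ^ 2 + 2 * inner ℝ (a - c) (φ x • (w x - a)))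
    (dev_sq.add cross) (hφi.mul_const _), integral_add dev_sq cross,
    integral_const_mul, cross_eq_zero, mul_zero, add_zero, integral_mul_const]

end WeightedMean

section MeanProjection

variable {X F ι : Type*} [MeasurableSpace X] {μ : Measure X} [NormedAddCommGroup F]
  [InnerProductSpace ℝ F] {J : Finset ι} {Φ : ι → X → ℝ} {v w : X → F}

lemma integrable_inner_of_memLp_two (hw : MemLp w 2 μ) (hv : MemLp v 2 μ) :
    Integrable (fun x => inner ℝ (w x) (v x)) μ := by
  refine (L2.integrable_inner (𝕜 := ℝ) (hw.toLp w) (hv.toLp v)).congr ?_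
  filter_upwards [hw.coeFn_toLp, hv.coeFn_toLp] with x hx hx'
  rw [hx, hx']

lemma norm_toLp_two (hw : MemLp w 2 μ) : ‖hw.toLp w‖ = √(∫ x, ‖w x‖ ^ 2 ∂μ) := by
  rw [← Real.sqrt_sq (norm_nonneg _), ← real_inner_self_eq_norm_sq, L2.inner_def]
  congr 1
  refine integral_congr_ae ?_
  filter_upwards [hw.coeFn_toLp] with x hx
  rw [hx, real_inner_self_eq_norm_sq]

lemma abs_integral_inner_le (hw : MemLp w 2 μ) (hv : MemLp v 2 μ) :
    |∫ x, inner ℝ (w x) (v x) ∂μ| ≤ √(∫ x, ‖w x‖ ^ 2 ∂μ) * √(∫ x, ‖v x‖ ^ 2 ∂μ) := by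
  rw [← norm_toLp_two hw, ← norm_toLp_two hv]
  convert abs_real_inner_le_norm (hw.toLp w) (hv.toLp v) using 2
  rw [L2.inner_def]
  refine integral_congr_ae ?_
  filter_upwards [hw.coeFn_toLp, hv.coeFn_toLp] with x hx hx'
  rw [hx, hx']

/-- A finite family of measurable nonnegative weights whose sum is almost everywhere at most `1`:
part of a partition of unity. -/
structure IsSubpartition (μ : Measure X) (J : Finset ι) (Φ : ι → X → ℝ) : Prop where
  aestronglyMeasurable : ∀ j ∈ J, AEStronglyMeasurable (Φ j) μ
  nonneg : ∀ j ∈ J, 0 ≤ᵐ[μ] Φ j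
  sum_le_one : ∀ᵐ x ∂μ, ∑ j ∈ J, Φ j x ≤ 1

/-- The lumped-mass projection onto the span of the weights `Φ`, with the weighted means as
coefficients. -/
noncomputable def meanProj (μ : Measure X) (J : Finset ι) (Φ : ι → X → ℝ) (w : X → F) : X → F :=
  fun x => ∑ j ∈ J, Φ j x • weightedMean μ (Φ j) w

namespace IsSubpartition

variable {j : ι}

lemma ae_nonneg (hΦ : IsSubpartition μ J Φ) : ∀ᵐ x ∂μ, ∀ j ∈ J, 0 ≤ Φ j x :=
  J.eventually_all.2 hΦ.nonneg

lemma mono (hΦ : IsSubpartition μ J Φ) {I : Finset ι} (hI : I ⊆ J) : IsSubpartition μ I Φ where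
  aestronglyMeasurable j hj := hΦ.aestronglyMeasurable j (hI hj)
  nonneg j hj := hΦ.nonneg j (hI hj)
  sum_le_one := by
    filter_upwards [hΦ.ae_nonneg, hΦ.sum_le_one] with x nonneg sum_le
    exact (Finset.sum_le_sum_of_subset_of_nonneg hI fun j hj _ => nonneg j hj).trans sum_le

lemma ae_le_one (hΦ : IsSubpartition μ J Φ) (hj : j ∈ J) : ∀ᵐ x ∂μ, Φ j x ≤ 1 := by
  filter_upwards [hΦ.ae_nonneg, hΦ.sum_le_one] with x nonneg sum_le
  exact (Finset.single_le_sum nonneg hj).trans sum_le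

lemma integrable_smul {H : Type*} [NormedAddCommGroup H] [NormedSpace ℝ H] {u : X → H}
    (hΦ : IsSubpartition μ J Φ) (hj : j ∈ J) (hu : Integrable u μ) :
    Integrable (fun x => Φ j x • u x) μ := by
  refine hu.bdd_smul 1 (hΦ.aestronglyMeasurable j hj) ?_
  filter_upwards [hΦ.nonneg j hj, hΦ.ae_le_one hj] with x nonneg le_one
  rwa [Real.norm_of_nonneg nonneg]

lemma integrable_mul_norm_sq {H : Type*} [NormedAddCommGroup H] {u : X → H}
    (hΦ : IsSubpartition μ J Φ) (hj : j ∈ J) (hu : MemLp u 2 μ) :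
    Integrable (fun x => Φ j x * ‖u x‖ ^ 2) μ :=
  hΦ.integrable_smul hj (hu.integrable_norm_pow two_ne_zero)

variable [IsFiniteMeasure μ]

lemma integrable (hΦ : IsSubpartition μ J Φ) (hj : j ∈ J) : Integrable (Φ j) μ := by
  simpa only [smul_eq_mul, mul_one] using hΦ.integrable_smul hj (integrable_const (1 : ℝ))

lemma integrable_inner_meanProj (hΦ : IsSubpartition μ J Φ) (w : X → F) (hv : MemLp v 2 μ) :
    Integrable (fun x => inner ℝ (meanProj μ J Φ w x) (v x)) μ := by
  simp only [meanProj, sum_inner, real_inner_smul_left]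
  exact integrable_finsetSum _ fun j hj =>
    hΦ.integrable_smul hj ((hv.integrable one_le_two).const_inner _)

variable [CompleteSpace F]

lemma integral_mul_norm_sub_sq (hΦ : IsSubpartition μ J Φ) (hj : j ∈ J) (hw : MemLp w 2 μ)
    (c : F) :
    ∫ x, Φ j x * ‖w x - c‖ ^ 2 ∂μ = ∫ x, Φ j x * ‖w x - weightedMean μ (Φ j) w‖ ^ 2 ∂μ +
      (∫ x, Φ j x ∂μ) * ‖weightedMean μ (Φ j) w - c‖ ^ 2 :=
  PG.integral_mul_norm_sub_sq (hΦ.nonneg j hj) (hΦ.integrable hj)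
    (hΦ.integrable_smul hj (hw.integrable one_le_two)) (hΦ.integrable_mul_norm_sq hj hw) c

lemma integral_inner_meanProj (hΦ : IsSubpartition μ J Φ) (w : X → F) (hv : MemLp v 2 μ) :
    ∫ x, inner ℝ (meanProj μ J Φ w x) (v x) ∂μ = ∑ j ∈ J, (∫ x, Φ j x ∂μ) *
      inner ℝ (weightedMean μ (Φ j) w) (weightedMean μ (Φ j) v) := by
  have integrable_smul (j) (hj : j ∈ J) : Integrable (fun x => Φ j x • v x) μ :=
    hΦ.integrable_smul hj (hv.integrable one_le_two)
  simp only [meanProj, sum_inner, real_inner_smul_left, ← real_inner_smul_right]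
  rw [integral_finsetSum _ fun j hj => (integrable_smul j hj).const_inner _]
  refine Finset.sum_congr rfl fun j hj => ?_
  rw [integral_inner (integrable_smul j hj),
    integral_smul_weightedMean (hΦ.nonneg j hj) (hΦ.integrable hj)]

lemma sum_mul_norm_weightedMean_sq_le (hΦ : IsSubpartition μ J Φ) (hw : MemLp w 2 μ) :
    ∑ j ∈ J, (∫ x, Φ j x ∂μ) * ‖weightedMean μ (Φ j) w‖ ^ 2 ≤ ∫ x, ‖w x‖ ^ 2 ∂μ :=
  calc ∑ j ∈ J, (∫ x, Φ j x ∂μ) * ‖weightedMean μ (Φ j) w‖ ^ 2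
      ≤ ∑ j ∈ J, ∫ x, Φ j x * ‖w x‖ ^ 2 ∂μ := Finset.sum_le_sum fun j hj => by
        have := hΦ.integral_mul_norm_sub_sq hj hw 0
        simp only [sub_zero] at this
        rw [this]
        exact le_add_of_nonneg_left (integral_nonneg_of_ae
          ((hΦ.nonneg j hj).mono fun x hx => mul_nonneg hx (sq_nonneg _)))
    _ = ∫ x, ∑ j ∈ J, Φ j x * ‖w x‖ ^ 2 ∂μ :=
        (integral_finsetSum _ fun j hj => hΦ.integrable_mul_norm_sq hj hw).symm
    _ ≤ ∫ x, ‖w x‖ ^ 2 ∂μ := by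
        refine integral_mono_ae
          (integrable_finsetSum _ fun j hj => hΦ.integrable_mul_norm_sq hj hw)
          hw.integrable_norm_pow' ?_
        filter_upwards [hΦ.sum_le_one] with x hx
        rw [← Finset.sum_mul]
        exact mul_le_of_le_one_left (sq_nonneg _) hx

lemma abs_integral_inner_meanProj_le (hΦ : IsSubpartition μ J Φ) (hw : MemLp w 2 μ)
    (hv : MemLp v 2 μ) :
    |∫ x, inner ℝ (meanProj μ J Φ w x) (v x) ∂μ| ≤
      √(∫ x, ‖w x‖ ^ 2 ∂μ) * √(∫ x, ‖v x‖ ^ 2 ∂μ) := by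
  have mass_nonneg (j) (hj : j ∈ J) : 0 ≤ ∫ x, Φ j x ∂μ := integral_nonneg_of_ae (hΦ.nonneg j hj)
  let a (u : X → F) (j : ι) : ℝ := √(∫ x, Φ j x ∂μ) * ‖weightedMean μ (Φ j) u‖
  have sum_sq_le {u : X → F} (hu : MemLp u 2 μ) : ∑ j ∈ J, a u j ^ 2 ≤ ∫ x, ‖u x‖ ^ 2 ∂μ := by
    refine (Finset.sum_congr rfl fun j hj => ?_).trans_le (hΦ.sum_mul_norm_weightedMean_sq_le hu)
    rw [mul_pow, Real.sq_sqrt (mass_nonneg j hj)]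
  calc |∫ x, inner ℝ (meanProj μ J Φ w x) (v x) ∂μ|
      ≤ ∑ j ∈ J, |(∫ x, Φ j x ∂μ) *
          inner ℝ (weightedMean μ (Φ j) w) (weightedMean μ (Φ j) v)| := by
        rw [hΦ.integral_inner_meanProj w hv]
        exact Finset.abs_sum_le_sum_abs _ _
    _ ≤ ∑ j ∈ J, a w j * a v j := Finset.sum_le_sum fun j hj => by
        rw [mul_mul_mul_comm, Real.mul_self_sqrt (mass_nonneg j hj), abs_mul,
          abs_of_nonneg (mass_nonneg j hj)]
        exact mul_le_mul_of_nonneg_left (abs_real_inner_le_norm _ _) (mass_nonneg j hj)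
    _ ≤ √(∑ j ∈ J, a w j ^ 2) * √(∑ j ∈ J, a v j ^ 2) := Real.sum_mul_le_sqrt_mul_sqrt _ _ _
    _ ≤ √(∫ x, ‖w x‖ ^ 2 ∂μ) * √(∫ x, ‖v x‖ ^ 2 ∂μ) := by
        gcongr <;> exact sum_sq_le ‹_›

theorem abs_integral_inner_sub_meanProj_le (hΦ : IsSubpartition μ J Φ) (hw : MemLp w 2 μ)
    (hv : MemLp v 2 μ) :
    |∫ x, inner ℝ (w x - meanProj μ J Φ w x) (v x) ∂μ| ≤
      2 * (√(∫ x, ‖w x‖ ^ 2 ∂μ) * √(∫ x, ‖v x‖ ^ 2 ∂μ)) := by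
  simp_rw [inner_sub_left]
  rw [integral_sub (integrable_inner_of_memLp_two hw hv) (hΦ.integrable_inner_meanProj w hv),
    two_mul]
  exact (abs_sub _ _).trans
    (add_le_add (abs_integral_inner_le hw hv) (hΦ.abs_integral_inner_meanProj_le hw hv))

theorem integral_inner_sub_meanProj_self_le (hΦ : IsSubpartition μ J Φ)
    (hsum : ∀ᵐ x ∂μ, ∑ j ∈ J, Φ j x = 1) (hw : MemLp w 2 μ) (c : ι → F) :
    ∫ x, inner ℝ (w x - meanProj μ J Φ w x) (w x) ∂μ ≤
      ∑ j ∈ J, ∫ x, Φ j x * ‖w x - c j‖ ^ 2 ∂μ := by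
  have split : ∫ x, inner ℝ (w x) (w x) ∂μ = ∑ j ∈ J, ∫ x, Φ j x * ‖w x‖ ^ 2 ∂μ := by
    rw [← integral_finsetSum _ fun j hj => hΦ.integrable_mul_norm_sq hj hw]
    refine integral_congr_ae ?_
    filter_upwards [hsum] with x hx
    rw [← Finset.sum_mul, hx, one_mul, real_inner_self_eq_norm_sq]
  simp_rw [inner_sub_left]
  rw [integral_sub (integrable_inner_of_memLp_two hw hw) (hΦ.integrable_inner_meanProj w hw),
    split, hΦ.integral_inner_meanProj w hw, ← Finset.sum_sub_distrib]
  refine Finset.sum_le_sum fun j hj => ?_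
  have origin := hΦ.integral_mul_norm_sub_sq hj hw 0
  simp only [sub_zero] at origin
  rw [origin, real_inner_self_eq_norm_sq, add_sub_cancel_right,
    hΦ.integral_mul_norm_sub_sq hj hw (c j)]
  exact le_add_of_nonneg_right
    (mul_nonneg (integral_nonneg_of_ae (hΦ.nonneg j hj)) (sq_nonneg _))

end IsSubpartition

end MeanProjection

/-! ### The nodal partition of unity -/

section MeshDomain

variable {d : ℕ} {S : Finset (Finset (E d))} {K : Finset (E d)} {h θ : ℝ}

lemma meshDomain_ae_eq (S : Finset (Finset (E d))) :
    (meshDomain S : Set (E d)) =ᵐ[volume] ⋃ K ∈ S, cell K := by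
  refine interior_subset.eventuallyLE.antisymm ?_
  refine (Filter.EventuallyLE.countable_bUnion S.countable_toSet fun K _ =>
    (interior_cell_ae_eq K).symm.le).trans (LE.le.eventuallyLE ?_)
  exact Set.iUnion₂_subset fun K hK => interior_cell_subset_meshDomain hK

lemma ae_restrict_meshDomain_iff {p : E d → Prop} :
    (∀ᵐ x ∂volume.restrict (meshDomain S), p x) ↔
      ∀ K ∈ S, ∀ᵐ x ∂volume.restrict (cell K), p x := by
  rw [Measure.restrict_congr_set (meshDomain_ae_eq S), ae_restrict_biUnion_finset_iff]

instance isFiniteMeasure_restrict_meshDomain (S : Finset (Finset (E d))) :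
    IsFiniteMeasure (volume.restrict (meshDomain S)) := by
  refine isFiniteMeasure_restrict.2 (ne_top_of_le_ne_top ?_ (measure_mono interior_subset))
  exact (S.isCompact_biUnion fun K _ => isCompact_cell K).measure_lt_top.ne

namespace IsMesh

lemma pairwise_aedisjoint_cell (hS : IsMesh S h θ) :
    (S : Set (Finset (E d))).Pairwise (Function.onFun (AEDisjoint volume) cell) :=
  fun K hK L hL hKL =>
    (hS.isSimplex K hK).aedisjoint_cell (hS.isSimplex L hL) (hS.conforming K hK L hL) hKL

lemma lintegral_meshDomain (hS : IsMesh S h θ) (f : E d → ℝ≥0∞) :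
    ∫⁻ x in meshDomain S, f x = ∑ K ∈ S, ∫⁻ x in cell K, f x := by
  rw [Measure.restrict_congr_set (meshDomain_ae_eq S), lintegral_biUnion_finset₀
    hS.pairwise_aedisjoint_cell fun K _ => (isCompact_cell K).measurableSet.nullMeasurableSet]

lemma ae_eq_of_mem_cell (hS : IsMesh S h θ) (hK : K ∈ S) :
    ∀ᵐ x ∂volume.restrict (cell K), ∀ L ∈ S, x ∈ cell L → L = K := by
  rw [Finset.eventually_all]
  intro L hL
  obtain rfl | hLK := eq_or_ne L K
  · exact .of_forall fun _ _ => rfl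
  rw [ae_restrict_iff' (isCompact_cell K).measurableSet]
  have := measure_eq_zero_iff_ae_notMem.1 (hS.pairwise_aedisjoint_cell hK hL hLK.symm)
  filter_upwards [this] with x hx hxK hxL
  exact absurd ⟨hxK, hxL⟩ hx

end IsMesh

end MeshDomain

section Nodes

variable {d : ℕ} {S : Finset (Finset (E d))} {K L : Finset (E d)} {z : E d}
  {j : E d × Finset (Finset (E d))} {h θ : ℝ}

lemma mem_nodes_iff : j ∈ nodes S ↔ ∃ K ∈ S, ∃ z ∈ K, (z, patch S K z) = j := by
  simp [nodes]

lemma patch_eq_of_mem (hL : L ∈ patch S K z) : patch S L z = patch S K z := by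
  have hKL := (mem_patch_iff.1 hL).2
  have : Std.Symm (FacetAdj S z) := ⟨fun _ _ h => h.symm⟩
  have hLK : Relation.ReflTransGen (FacetAdj S z) L K := Std.Symm.symm _ _ hKL
  ext M
  rw [mem_patch_iff, mem_patch_iff]
  exact and_congr_right fun _ => ⟨hKL.trans, hLK.trans⟩

lemma mem_snd_iff_of_mem_nodes (hj : j ∈ nodes S) (hK : K ∈ S) :
    K ∈ j.2 ↔ ∃ z ∈ K, (z, patch S K z) = j := by
  constructor
  · obtain ⟨L, -, z, hz, rfl⟩ := mem_nodes_iff.1 hj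
    exact fun hKL => ⟨z, mem_of_mem_patch hz hKL, by rw [patch_eq_of_mem hKL]⟩
  · rintro ⟨z, -, rfl⟩
    exact mem_patch_iff.2 ⟨hK, .refl⟩

lemma snd_subset_of_mem_nodes (hj : j ∈ nodes S) : j.2 ⊆ S := by
  obtain ⟨K, -, z, -, rfl⟩ := mem_nodes_iff.1 hj
  exact patch_subset S K z

lemma fst_mem_of_mem_snd (hj : j ∈ nodes S) (hK : K ∈ j.2) : j.1 ∈ K := by
  obtain ⟨z, hz, rfl⟩ := (mem_snd_iff_of_mem_nodes hj (snd_subset_of_mem_nodes hj hK)).1 hK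
  exact hz

open Classical in
lemma filter_mem_nodes_eq_image (hK : K ∈ S) :
    (nodes S).filter (fun j => K ∈ j.2) = K.image fun z => (z, patch S K z) := by
  ext j
  rw [Finset.mem_filter, Finset.mem_image]
  refine ⟨fun ⟨hj, hKj⟩ => (mem_snd_iff_of_mem_nodes hj hK).1 hKj, fun hjK => ?_⟩
  have hj : j ∈ nodes S := mem_nodes_iff.2 ⟨K, hK, hjK⟩
  exact ⟨hj, (mem_snd_iff_of_mem_nodes hj hK).2 hjK⟩

lemma sum_nodes_sum_eq_sum_card_nsmul {M : Type*} [AddCommMonoid M] (a : Finset (E d) → M) :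
    ∑ j ∈ nodes S, ∑ K ∈ j.2, a K = ∑ K ∈ S, K.card • a K := by
  classical
  rw [Finset.sum_comm' (t' := S) (s' := fun K => (nodes S).filter (fun j => K ∈ j.2))
    fun j K => ?_]
  · refine Finset.sum_congr rfl fun K hK => ?_
    rw [Finset.sum_const, filter_mem_nodes_eq_image hK,
      Finset.card_image_of_injective _ fun _ _ h => (Prod.mk.inj h).1]
  · rw [Finset.mem_filter]
    exact ⟨fun ⟨hj, hK⟩ => ⟨⟨hj, hK⟩, snd_subset_of_mem_nodes hj hK⟩, And.left⟩

namespace IsMesh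

open Classical in
lemma hat_ae_eq (hS : IsMesh S h θ) (hj : j ∈ nodes S) (hK : K ∈ S) :
    hat j =ᵐ[volume.restrict (cell K)] fun x => if K ∈ j.2 then bary K j.1 x else 0 := by
  filter_upwards [ae_restrict_mem (isCompact_cell K).measurableSet, hS.ae_eq_of_mem_cell hK]
    with x hxK unique
  by_cases hKj : K ∈ j.2
  · have cover : ∃ L ∈ j.2, x ∈ cell L := ⟨K, hKj, hxK⟩
    obtain ⟨hL, hxL⟩ := cover.choose_spec
    rw [hat, dif_pos cover, if_pos hKj, unique _ (snd_subset_of_mem_nodes hj hL) hxL]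
  · rw [hat, dif_neg, if_neg hKj]
    rintro ⟨L, hL, hxL⟩
    exact hKj (unique L (snd_subset_of_mem_nodes hj hL) hxL ▸ hL)

lemma sum_hat_ae_eq_one (hS : IsMesh S h θ) :
    ∀ᵐ x ∂volume.restrict (meshDomain S), ∑ j ∈ nodes S, hat j x = 1 := by
  classical
  refine ae_restrict_meshDomain_iff.2 fun K hK => ?_
  filter_upwards [(nodes S).eventually_all.2 fun j hj => hS.hat_ae_eq hj hK] with x hx
  rw [Finset.sum_congr rfl hx, ← Finset.sum_filter, filter_mem_nodes_eq_image hK,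
    Finset.sum_image fun _ _ _ _ h => (Prod.mk.inj h).1]
  exact (hS.isSimplex K hK).sum_bary x

lemma isSubpartition_hat (hS : IsMesh S h θ) :
    IsSubpartition (volume.restrict (meshDomain S)) (nodes S) hat where
  aestronglyMeasurable j hj := by
    classical
    rw [Measure.restrict_congr_set (meshDomain_ae_eq S), ← Finset.set_biUnion_coe,
      Set.biUnion_eq_iUnion, aestronglyMeasurable_iUnion_iff]
    rintro ⟨K, hK⟩
    refine AEStronglyMeasurable.congr ?_ (hS.hat_ae_eq hj hK).symm
    split_ifs with hKj
    · exact ((hS.isSimplex K hK).continuous_bary (fst_mem_of_mem_snd hj hKj)).aestronglyMeasurable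
    · exact aestronglyMeasurable_const
  nonneg j hj := by
    classical
    refine ae_restrict_meshDomain_iff.2 fun K hK => ?_
    filter_upwards [hS.hat_ae_eq hj hK, ae_restrict_mem (isCompact_cell K).measurableSet]
      with x hx hxK
    rw [hx, Pi.zero_apply]
    split_ifs with hKj
    · exact ((hS.isSimplex K hK).bary_mem_Icc (fst_mem_of_mem_snd hj hKj) hxK).1
    · exact le_rfl
  sum_le_one := hS.sum_hat_ae_eq_one.mono fun _ => le_of_eq

lemma lintegral_hat_mul_le (hS : IsMesh S h θ) (hj : j ∈ nodes S) (f : E d → ℝ≥0∞) :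
    ∫⁻ x in meshDomain S, ENNReal.ofReal (hat j x) * f x ≤
      ∑ K ∈ j.2, ∫⁻ x in cell K, f x := by
  classical
  rw [hS.lintegral_meshDomain, ← Finset.sum_subset (snd_subset_of_mem_nodes hj) fun K hK hKj => ?_]
  · refine Finset.sum_le_sum fun K hKj => lintegral_mono_ae ?_
    filter_upwards [ae_restrict_meshDomain_iff.1 (hS.isSubpartition_hat.ae_le_one hj) K
      (snd_subset_of_mem_nodes hj hKj)] with x hx
    exact mul_le_of_le_one_left' (ENNReal.ofReal_le_one.2 hx)
  · refine (lintegral_congr_ae ?_).trans lintegral_zero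
    filter_upwards [hS.hat_ae_eq hj hK] with x hx
    rw [hx, if_neg hKj, ENNReal.ofReal_zero, zero_mul]

end IsMesh

end Nodes

/-! ### The stabilization form -/

section WeakConsistency

variable {d : ℕ} {S : Finset (Finset (E d))} {K : Finset (E d)} {z : E d} {h θ : ℝ}
  {ι : Type*} [Fintype ι] {w : E d → EuclideanSpace ℝ ι} {G : ι → E d → E d}

lemma enorm_sq_eq_sum (x : EuclideanSpace ℝ ι) : ‖x‖ₑ ^ 2 = ∑ i, ‖x i‖ₑ ^ 2 := by
  simp_rw [← ofReal_norm, ← ENNReal.ofReal_pow (norm_nonneg _), EuclideanSpace.norm_sq_eq]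
  exact ENNReal.ofReal_sum_of_nonneg fun _ _ => sq_nonneg _

lemma ofReal_integral_norm_sq {X F : Type*} [MeasurableSpace X] [NormedAddCommGroup F]
    {μ : Measure X} {u : X → F} (hu : MemLp u 2 μ) :
    ENNReal.ofReal (∫ x, ‖u x‖ ^ 2 ∂μ) = ∫⁻ x, ‖u x‖ₑ ^ 2 ∂μ := by
  rw [ofReal_integral_eq_lintegral_ofReal (hu.integrable_norm_pow two_ne_zero)
    (.of_forall fun _ => sq_nonneg _)]
  exact lintegral_congr fun x => by rw [ENNReal.ofReal_pow (norm_nonneg _), ofReal_norm]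

lemma IsSubpartition.ofReal_integral_mul_norm_sq {X F ι : Type*} [MeasurableSpace X]
    [NormedAddCommGroup F] {μ : Measure X} {J : Finset ι} {Φ : ι → X → ℝ} {j : ι} {u : X → F}
    (hΦ : IsSubpartition μ J Φ) (hj : j ∈ J) (hu : MemLp u 2 μ) :
    ENNReal.ofReal (∫ x, Φ j x * ‖u x‖ ^ 2 ∂μ) = ∫⁻ x, ENNReal.ofReal (Φ j x) * ‖u x‖ₑ ^ 2 ∂μ := by
  rw [ofReal_integral_eq_lintegral_ofReal (hΦ.integrable_mul_norm_sq hj hu)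
    ((hΦ.nonneg j hj).mono fun x hx => mul_nonneg hx (sq_nonneg _))]
  refine lintegral_congr_ae ((hΦ.nonneg j hj).mono fun x hx => ?_)
  simp only [ENNReal.ofReal_mul hx, ENNReal.ofReal_pow (norm_nonneg _), ofReal_norm]

namespace IsMesh

lemma exists_sum_lintegral_vec_sub_sq_le_patch (hS : IsMesh S h θ)
    (hw : IntegrableOn w (meshDomain S)) (hG : ∀ i, IntegrableOn (G i) (meshDomain S))
    (hwG : ∀ i, IsWeakGrad (meshDomain S) (fun x => w x i) (G i)) (hK : K ∈ S) (hz : z ∈ K) :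
    ∃ c, ∑ L ∈ patch S K z, ∫⁻ x in cell L, ‖w x - c‖ₑ ^ 2 ≤
      patchConst d θ * ENNReal.ofReal (h ^ 2) *
        ∑ L ∈ patch S K z, ∑ i, ∫⁻ x in cell L, ‖G i x‖ₑ ^ 2 := by
  have hwi (i : ι) : IntegrableOn (fun x => w x i) (meshDomain S) := hw.eval_piLp i
  choose c hc using fun i => hS.exists_sum_lintegral_sub_sq_le_patch (hwi i) (hG i) (hwG i) hK hz
  refine ⟨WithLp.toLp 2 c, ?_⟩
  calc ∑ L ∈ patch S K z, ∫⁻ x in cell L, ‖w x - WithLp.toLp 2 c‖ₑ ^ 2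
      = ∑ L ∈ patch S K z, ∑ i, ∫⁻ x in cell L, ‖w x i - c i‖ₑ ^ 2 := by
        refine Finset.sum_congr rfl fun L hL => ?_
        simp_rw [enorm_sq_eq_sum]
        refine lintegral_finsetSum' _ fun i _ => ?_
        exact ((aestronglyMeasurable_cell (hwi i).aestronglyMeasurable
          (patch_subset S K z hL)).sub aestronglyMeasurable_const).enorm.pow_const 2
    _ = ∑ i, ∑ L ∈ patch S K z, ∫⁻ x in cell L, ‖w x i - c i‖ₑ ^ 2 := Finset.sum_comm
    _ ≤ ∑ i, patchConst d θ * ENNReal.ofReal (h ^ 2) *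
          ∑ L ∈ patch S K z, ∫⁻ x in cell L, ‖G i x‖ₑ ^ 2 :=
        Finset.sum_le_sum fun i _ => hc i
    _ = _ := by rw [← Finset.mul_sum, Finset.sum_comm]

lemma exists_sum_lintegral_hat_mul_le (hS : IsMesh S h θ) (hw : IntegrableOn w (meshDomain S))
    (hG : ∀ i, IntegrableOn (G i) (meshDomain S))
    (hwG : ∀ i, IsWeakGrad (meshDomain S) (fun x => w x i) (G i)) :
    ∃ c : E d × Finset (Finset (E d)) → EuclideanSpace ℝ ι,
      ∑ j ∈ nodes S, ∫⁻ x in meshDomain S, ENNReal.ofReal (hat j x) * ‖w x - c j‖ₑ ^ 2 ≤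
        (d + 1) * patchConst d θ * ENNReal.ofReal (h ^ 2) *
          ∑ i, ∫⁻ x in meshDomain S, ‖G i x‖ₑ ^ 2 := by
  have poincare (j) (hj : j ∈ nodes S) : ∃ c, ∑ K ∈ j.2, ∫⁻ x in cell K, ‖w x - c‖ₑ ^ 2 ≤
      patchConst d θ * ENNReal.ofReal (h ^ 2) *
        ∑ K ∈ j.2, ∑ i, ∫⁻ x in cell K, ‖G i x‖ₑ ^ 2 := by
    obtain ⟨K, hK, z, hz, rfl⟩ := mem_nodes_iff.1 hj
    exact hS.exists_sum_lintegral_vec_sub_sq_le_patch hw hG hwG hK hz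
  choose! c hc using poincare
  refine ⟨c, ?_⟩
  calc ∑ j ∈ nodes S, ∫⁻ x in meshDomain S, ENNReal.ofReal (hat j x) * ‖w x - c j‖ₑ ^ 2
      ≤ ∑ j ∈ nodes S, patchConst d θ * ENNReal.ofReal (h ^ 2) *
          ∑ K ∈ j.2, ∑ i, ∫⁻ x in cell K, ‖G i x‖ₑ ^ 2 :=
        Finset.sum_le_sum fun j hj => (hS.lintegral_hat_mul_le hj _).trans (hc j hj)
    _ = patchConst d θ * ENNReal.ofReal (h ^ 2) *
          ∑ K ∈ S, (d + 1) * ∑ i, ∫⁻ x in cell K, ‖G i x‖ₑ ^ 2 := by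
        rw [← Finset.mul_sum, sum_nodes_sum_eq_sum_card_nsmul]
        congr 1
        refine Finset.sum_congr rfl fun K hK => ?_
        rw [(hS.isSimplex K hK).card_eq, nsmul_eq_mul, Nat.cast_succ]
    _ = _ := by
        simp_rw [hS.lintegral_meshDomain]
        rw [Finset.sum_comm (s := Finset.univ), ← Finset.mul_sum]
        ring

theorem integral_inner_sub_meanProj_hat_self_le (hS : IsMesh S h θ)
    (hw : MemLp w 2 (volume.restrict (meshDomain S)))
    (hG : ∀ i, MemLp (G i) 2 (volume.restrict (meshDomain S)))
    (hwG : ∀ i, IsWeakGrad (meshDomain S) (fun x => w x i) (G i)) :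
    ∫ x in meshDomain S, inner ℝ
        (w x - meanProj (volume.restrict (meshDomain S)) (nodes S) hat w x) (w x) ≤
      (d + 1) * patchConst d θ * h ^ 2 * ∑ i, ∫ x in meshDomain S, ‖G i x‖ ^ 2 := by
  have hΦ := hS.isSubpartition_hat
  obtain ⟨c, hc⟩ := hS.exists_sum_lintegral_hat_mul_le (hw.integrable one_le_two)
    (fun i => (hG i).integrable one_le_two) hwG
  refine (hΦ.integral_inner_sub_meanProj_self_le hS.sum_hat_ae_eq_one hw c).trans ?_
  have deviation : ENNReal.ofReal (∑ j ∈ nodes S, ∫ x in meshDomain S, hat j x * ‖w x - c j‖ ^ 2) =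
      ∑ j ∈ nodes S, ∫⁻ x in meshDomain S, ENNReal.ofReal (hat j x) * ‖w x - c j‖ₑ ^ 2 := by
    rw [ENNReal.ofReal_sum_of_nonneg fun j hj => integral_nonneg_of_ae
      ((hΦ.nonneg j hj).mono fun x hx => mul_nonneg hx (sq_nonneg _))]
    exact Finset.sum_congr rfl fun j hj =>
      hΦ.ofReal_integral_mul_norm_sq hj (hw.sub (memLp_const (c j)))
  have energy : ENNReal.ofReal (∑ i, ∫ x in meshDomain S, ‖G i x‖ ^ 2) =
      ∑ i, ∫⁻ x in meshDomain S, ‖G i x‖ₑ ^ 2 := by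
    rw [ENNReal.ofReal_sum_of_nonneg fun i _ => integral_nonneg fun _ => sq_nonneg _]
    exact Finset.sum_congr rfl fun i _ => ofReal_integral_norm_sq (hG i)
  rw [← ENNReal.ofReal_le_ofReal_iff (by positivity), deviation,
    ENNReal.ofReal_mul (by positivity), energy]
  refine hc.trans_eq ?_
  rw [ENNReal.ofReal_mul (by positivity), ENNReal.ofReal_mul (by positivity),
    ENNReal.ofReal_natCast, ← Nat.cast_succ, ← Nat.cast_succ, ENNReal.ofReal_natCast]

end IsMesh

end WeakConsistency

section Stabilization

variable {d : ℕ} {S : Finset (Finset (E d))} {h θ : ℝ} {U : Set (E d)} {u v : E d → ℝ}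

lemma MemH1.memLp_weakGrad (hu : MemH1 U u) : MemLp (weakGrad U u) 2 (volume.restrict U) := by
  rw [weakGrad, dif_pos hu.2]
  exact hu.2.choose_spec.1

lemma MemH1.isWeakGrad (hu : MemH1 U u) : IsWeakGrad U u (weakGrad U u) := by
  rw [weakGrad, dif_pos hu.2]
  exact hu.2.choose_spec.2

lemma normH1_nonneg (U : Set (E d)) (u : E d → ℝ) : 0 ≤ normH1 U u := Real.sqrt_nonneg _

lemma sqrt_integral_weakGrad_le_normH1 (U : Set (E d)) (u : E d → ℝ) :
    √(∫ x in U, ‖weakGrad U u x‖ ^ 2) ≤ normH1 U u :=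
  Real.sqrt_le_sqrt (le_add_of_nonneg_left (integral_nonneg fun _ => sq_nonneg _))

lemma sum_integral_weakGrad_weakPartial_le (U : Set (E d)) (u : E d → ℝ) :
    ∑ i : Fin d, ∫ x in U, ‖weakGrad U (weakPartial U u i) x‖ ^ 2 ≤ normH2 U u ^ 2 := by
  have normSqH1_nonneg : 0 ≤ normSqH1 U u := by unfold normSqH1; positivity
  have energy_nonneg : 0 ≤ ∑ i : Fin d, ∫ x in U, ‖weakGrad U (weakPartial U u i) x‖ ^ 2 := by
    positivity
  rw [normH2, normSqH2, Real.sq_sqrt (add_nonneg normSqH1_nonneg energy_nonneg)]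
  exact le_add_of_nonneg_left normSqH1_nonneg

lemma freeNodes_subset (S : Finset (Finset (E d))) (D : Set (E d)) : freeNodes S D ⊆ nodes S := by
  classical exact Finset.filter_subset _ _

lemma freeNodes_empty (S : Finset (Finset (E d))) : freeNodes S ∅ = nodes S := by
  simp [freeNodes]

lemma stab_eq_integral_meanProj (S : Finset (Finset (E d))) (D : Set (E d)) (u v : E d → ℝ) :
    stab S D u v = ∫ x in meshDomain S, inner ℝ (weakGrad (meshDomain S) u x -
      meanProj (volume.restrict (meshDomain S)) (freeNodes S D) hat
        (weakGrad (meshDomain S) u) x) (weakGrad (meshDomain S) v x) := rfl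

theorem IsMesh.abs_stab_le (hS : IsMesh S h θ) (D : Set (E d)) (hu : MemH1 (meshDomain S) u)
    (hv : MemH1 (meshDomain S) v) :
    |stab S D u v| ≤ 2 * normH1 (meshDomain S) u * normH1 (meshDomain S) v := by
  rw [stab_eq_integral_meanProj, mul_assoc]
  refine ((hS.isSubpartition_hat.mono
    (freeNodes_subset S D)).abs_integral_inner_sub_meanProj_le
      hu.memLp_weakGrad hv.memLp_weakGrad).trans ?_
  gcongr
  · exact normH1_nonneg _ u
  · exact sqrt_integral_weakGrad_le_normH1 _ u
  · exact sqrt_integral_weakGrad_le_normH1 _ v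

theorem IsMesh.stab_self_le (hS : IsMesh S h θ) (hu : MemH2 (meshDomain S) u) :
    stab S ∅ u u ≤ (d + 1) * patchConst d θ * h ^ 2 * normH2 (meshDomain S) u ^ 2 := by
  rw [stab_eq_integral_meanProj, freeNodes_empty]
  refine (hS.integral_inner_sub_meanProj_hat_self_le hu.1.memLp_weakGrad
    (fun i => (hu.2 i).memLp_weakGrad) fun i => (hu.2 i).isWeakGrad).trans ?_
  gcongr
  exact sum_integral_weakGrad_weakPartial_le _ u

end Stabilization

namespace Triangulation

variable {d : ℕ} {Ω : Set (E d)} {σ τ : ℝ} {K : Finset (E d)}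

lemma diam_cell_le_meshSize (T : Triangulation Ω) (hK : K ∈ T.cells) :
    Metric.diam (cell K) ≤ T.meshSize :=
  le_ciSup (f := fun K : T.cells => Metric.diam (cell (K : Finset (E d))))
    (Set.finite_range _).bddAbove ⟨K, hK⟩

lemma diam_cell_pos (T : Triangulation Ω) (hd : 0 < d) (hK : K ∈ T.cells) :
    0 < Metric.diam (cell K) := by
  obtain ⟨a, ha, b, hb, hab⟩ := Finset.one_lt_card.1 (by rw [T.card_eq K hK]; lia)
  exact (dist_pos.2 hab).trans_le (Metric.dist_le_diam_of_mem (isCompact_cell K).isBounded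
    (subset_convexHull ℝ _ ha) (subset_convexHull ℝ _ hb))

lemma isMesh (T : Triangulation Ω) (hd : 0 < d) (hσ : T.ShapeRegular σ) (hτ : T.QuasiUniform τ)
    {S : Finset (Finset (E d))} (hS : S ⊆ T.cells) (hS0 : S.Nonempty) :
    IsMesh S T.meshSize (max 1 (σ * τ)) := by
  have meshSize_pos : 0 < T.meshSize :=
    (T.diam_cell_pos hd (hS hS0.choose_spec)).trans_le
      (T.diam_cell_le_meshSize (hS hS0.choose_spec))
  refine ⟨meshSize_pos, le_max_left _ _, fun K hK => ⟨T.card_eq K (hS hK),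
    T.affineIndependent K (hS hK)⟩, fun K hK L hL => T.conforming K (hS hK) L (hS hL),
    fun K hK x hx y hy => ?_, fun K hK => ?_⟩
  · exact (Metric.dist_le_diam_of_mem (isCompact_cell K).isBounded hx hy).trans
      (T.diam_cell_le_meshSize (hS hK))
  · obtain ⟨x, ρ, hρ, ball_subset, diam_le⟩ := hσ K (hS hK)
    have τ_pos : 0 < τ :=
      pos_of_mul_pos_left (meshSize_pos.trans_le (hτ K (hS hK))) Metric.diam_nonneg
    refine ⟨x, (Metric.ball_subset_ball (div_le_of_le_mul₀ (by positivity) hρ.le ?_)).trans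
      ball_subset⟩
    calc T.meshSize ≤ τ * Metric.diam (cell K) := hτ K (hS hK)
      _ ≤ τ * (σ * ρ) := by gcongr
      _ = ρ * (σ * τ) := by ring
      _ ≤ ρ * max 1 (σ * τ) := by gcongr; exact le_max_right _ _

end Triangulation

lemma stab_empty {d : ℕ} (D : Set (E d)) (u v : E d → ℝ) : stab ∅ D u v = 0 := by
  simp [stab, meshDomain]

end PG

theorem lemma4p4_general {d : ℕ} (hd : 0 < d) (σ τ : ℝ) :
    ∃ c : ℝ, 0 < c ∧ ∀ (Ω : Set (PG.E d)) (T : PG.Triangulation Ω),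
      T.ShapeRegular σ → T.QuasiUniform τ → ∀ S ⊆ T.cells,
        (∀ (D : Set (PG.E d)) (u v : PG.E d → ℝ),
          PG.MemH1 (PG.meshDomain S) u → PG.MemH1 (PG.meshDomain S) v →
            |PG.stab S D u v| ≤
              c * PG.normH1 (PG.meshDomain S) u * PG.normH1 (PG.meshDomain S) v) ∧
        (∀ u : PG.E d → ℝ, PG.MemH2 (PG.meshDomain S) u →
          PG.stab S ∅ u u ≤ c * T.meshSize ^ 2 * PG.normH2 (PG.meshDomain S) u ^ 2) := by
  refine ⟨2 + (d + 1) * PG.patchConst d (max 1 (σ * τ)), by positivity,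
    fun Ω T hσ hτ S hS => ?_⟩
  have normH1_nonneg := PG.normH1_nonneg (PG.meshDomain S)
  obtain rfl | hS0 := S.eq_empty_or_nonempty
  · refine ⟨fun D u v _ _ => ?_, fun u _ => ?_⟩
    · rw [PG.stab_empty, abs_zero]
      exact mul_nonneg (mul_nonneg (by positivity) (normH1_nonneg u)) (normH1_nonneg v)
    · rw [PG.stab_empty]
      positivity
  have mesh := T.isMesh hd hσ hτ hS hS0
  refine ⟨fun D u v hu hv => (mesh.abs_stab_le D hu hv).trans ?_,
    fun u hu => (mesh.stab_self_le hu).trans ?_⟩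
  · gcongr
    · exact normH1_nonneg v
    · exact normH1_nonneg u
    · exact le_add_of_nonneg_right (by positivity)
  · gcongr
    exact le_add_of_nonneg_left zero_le_two

theorem lemma4p4 (d : ℕ) (hd : d = 2 ∨ d = 3) (σ τ : ℝ) :
    ∃ c : ℝ, 0 < c ∧
      ∀ (Ω Ωk : Set (PG.E d)), IsOpen Ω → IsOpen Ωk → Ωk.Nonempty → Ωk ⊆ Ω →
      ∀ T : PG.Triangulation Ω, T.ShapeRegular σ → T.QuasiUniform τ →
      ∀ δ : ℝ, 0 ≤ δ →
      ∀ (S : Finset (Finset (PG.E d))) (Ωh : Set (PG.E d)),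
        S = T.subcells Ωk δ → Ωh = PG.meshDomain S →
        -- continuity, with and without the nodes on the outer boundary
        (∀ D : Set (PG.E d), D = ∅ ∨ D = frontier Ω ∩ frontier Ωh →
          ∀ u v : PG.E d → ℝ, PG.MemH1 Ωh u → PG.MemH1 Ωh v →
            |PG.stab S D u v| ≤ c * PG.normH1 Ωh u * PG.normH1 Ωh v) ∧
        -- weak consistency
        (∀ u : PG.E d → ℝ, PG.MemH2 Ωh u →
          PG.stab S ∅ u u ≤ c * T.meshSize ^ 2 * PG.normH2 Ωh u ^ 2) := by
  obtain ⟨c, hc, estimates⟩ := lemma4p4_general (d := d) (by lia) σ τ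
  refine ⟨c, hc, fun Ω Ωk _ _ _ _ T hσ hτ δ _ S Ωh hS hΩh => hΩh ▸ ?_⟩
  have := estimates Ω T hσ hτ S (by classical exact hS ▸ Finset.filter_subset _ _)
  exact ⟨fun D _ => this.1 D, this.2⟩
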